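/- **Language.** Base types are $A,B ::= \mathtt I \mid A\oplus B\mid A\otimes B\mid \mu X.A\mid X$; put $\mathtt{nat}=\mu X.(\mathtt I\oplus X)$ and $[A]=\mu X.(\mathtt I\oplus(A\otimes X))$. Values, patterns, expressions, isos and terms are $$v ::= *\mid x\mid \mathsf{inl}\,v\mid \mathsf{inr}\,v\mid v\otimes v\mid \mathsf{fold}\,v,\qquad p ::= x\mid p\otimes p,\qquad e ::= v\mid \mathsf{let}\ p_1=\omega\,p_2\ \mathsf{in}\ e,$$ $$\omega ::= \{v_1\leftrightarrow e_1\mid\dots\mid v_n\leftrightarrow e_n\}\mid \mathsf{fix}\,\phi.\omega\mid\lambda\psi.\omega\mid\phi\mid\omega_1\omega_2,$$ $$t ::= *\mid x\mid \mathsf{inl}\,t\mid\mathsf{inr}\,t\mid t\otimes t\mid\mathsf{fold}\,t\mid\omega\,t\mid\mathsf{let}\ p=t\ \mathsf{in}\ t.$$ Tuples $(a,b,c)$ are nested pairs; $[\,]=\mathsf{fold}(\mathsf{inl}\,*)$, $h::t=\mathsf{fold}(\mathsf{inr}(h\otimes t))$, $0=\mathsf{fold}(\mathsf{inl}\,*)$,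 $S(v)=\mathsf{fold}(\mathsf{inr}\,v)$, $\mathtt{tt}=\mathsf{inl}\,*$, $\mathtt{ff}=\mathsf{inr}\,*$. For values $v,v'$, a valuation $\sigma$ (finite map from variables to values) *matches* $v'$ against $v$ if it is the smallest one with $\sigma(v)=v'$; in a pair the supports for the two components must be disjoint. Iso reduction is generated by $\mathsf{fix}\,\phi.\omega\to\omega[\mathsf{fix}\,\phi.\omega/\phi]$, $(\lambda\phi.\omega_1)\omega_2\to\omega_1[\omega_2/\phi]$, and $\omega_1\omega_2\to\omega_1'\omega_2$ if $\omega_1\to\omega_1'$. Term reduction is generated by $\{v_i\leftrightarrow e_i\}_i\,v'\to\sigma(e_i)$ if $\sigma$ matches $v'$ against $v_i$; $\mathsf{let}\ p=v\ \mathsf{in}\ t\to\sigma(t)$ if $\sigma$ matches $v$ against $p$; $\omega\,t\to\omega'\,t$ if $\omega\to\omega'$; and closure under the contexts $\mathsf{inl}[\cdot]$, $\mathsf{inr}[\cdot]$, $\mathsf{fold}[\cdot]$, $[\cdot]\otimes t$, $v\otimes[\cdot]$, $\{\dots\}[\cdot]$, $\mathsf{let}\ p=[\cdot]\ \mathsf{in}\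 t$. Write $\to^*$ for the reflexive transitive closure. The inverse $\omega^{-1}$ is obtained by replacing each clause $v\leftrightarrow\mathsf{let}\ p_1=\omega_1p_1'\ \mathsf{in}\dots\mathsf{let}\ p_k=\omega_kp_k'\ \mathsf{in}\ v'$ by $v'\leftrightarrow\mathsf{let}\ p_k'=\omega_k^{-1}p_k\ \mathsf{in}\dots\mathsf{let}\ p_1'=\omega_1^{-1}p_1\ \mathsf{in}\ v$, and by commuting with $\mathsf{fix}$, $\lambda$, iso variables and application. **Machines.** A Turing machine $M=(Q,\Sigma,\delta,b,q_s,q_f)$ has finite sets $Q$ of states and $\Sigma\ni b$ of symbols, and rules $\delta\subseteq Q\times[(\Sigma\times\Sigma)\cup\{\leftarrow,\downarrow,\rightarrow\}]\times Q$, none leading out of $q_f$ or into $q_s$; assume $q_s\neq q_f$. It is *reversible* (an RTM) if any two distinct rules with the same source state have actions $(s_1,s_1')$, $(s_2,s_2')$ with $s_1\ne s_2$, and any two distinct rules with the same target state have actions $(s_1,s_1')$, $(s_2,s_2')$ with $s_1'\ne s_2'$. A configuration is $(q,(l,s,r))$ with $l,r\in\Sigma^*$ the tape to the left and right of the scanned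 symbol $s$, extended by infinitely many blanks at the outer ends (strings that differ only by such blanks denote the same tape). A rule $(q,a,q')$ allows one step $\rightsquigarrow$ from state $q$ to $q'$: $(s,s')$ replaces the scanned symbol $s$ by $s'$, $\leftarrow$ and $\rightarrow$ move the head one cell left or right, $\downarrow$ changes nothing. $M^{-1}$ exchanges $q_s$ and $q_f$ and has the rules $(q',a^{-1},q)$ for $(q,a,q')\in\delta$, where $(s,s')^{-1}=(s',s)$, $\leftarrow^{-1}=\rightarrow$, $\rightarrow^{-1}=\leftarrow$, $\downarrow^{-1}=\downarrow$. **Encoding.** Enumerate $Q$ and $\Sigma$ in any way; $Q^T,\Sigma^T$ are the sums $\mathtt I\oplus\cdots\oplus\mathtt I$ of $|Q|$, resp. $|\Sigma|$, copies of $\mathtt I$, and $q^T$, $a^T$ are the corresponding injections of $*$. Let $C^T=Q^T\otimes([\Sigma^T]\otimes\Sigma^T\otimes[\Sigma^T])$ and let $\mathrm{isos}(q,(l,s,r))$ be the value $(q^T,(l^T,s^T,r^T))$ of this type, both lists starting next to the head. Use the following isos (constants $v$ as arguments are introduced by $\{x\leftrightarrow(x,v)\}$ and removed by its inverse $\mathrm{erase}_v$;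 constructors in arguments by the isos $\{x\leftrightarrow S(x)\}$, $\{(h,t)\leftrightarrow h::t\}$): * $\mathrm{Dup}_A: A\leftrightarrow A\otimes A$, by structural recursion on $A$: $\mathrm{Dup}_{\mathtt I}=\{*\leftrightarrow(*,*)\}$; pairs and injections are duplicated componentwise; $\mathrm{Dup}_{\mu X.A}=\mathsf{fix}\,\phi.\{\mathsf{fold}\,x\leftrightarrow\mathsf{let}\,(x_1,x_2)=\mathrm{Dup}_{A}\,x\ \mathsf{in}\ (\mathsf{fold}\,x_1,\mathsf{fold}\,x_2)\}$, with $\{x\leftrightarrow\mathsf{let}\,(x_1,x_2)=\phi\,x\ \mathsf{in}\,(x_1,x_2)\}$ at the variable $X$. * $\mathrm{len}=\mathsf{fix}\,\phi.\{[\,]\leftrightarrow([\,],0)\mid h::t\leftrightarrow\mathsf{let}\,(t',n)=\phi\,t\ \mathsf{in}\,(h::t',S(n))\}$. * $\mathrm{snoc}'=\mathsf{fix}\,\phi.\{([\,],x,0)\leftrightarrow\mathsf{let}\,(x_1,x_2)=\mathrm{Dup}\,x\ \mathsf{in}\,([x_1],x_2,0)\mid(h::t,x,S(n))\leftrightarrow\mathsf{let}\,(t',x',n')=\phi(t,x,n)\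 \mathsf{in}\,(h::t',x',S(n'))\}$. * $\mathrm{snoc}=\{(l,x)\leftrightarrow\mathsf{let}\,(l_1,n)=\mathrm{len}\,l\ \mathsf{in}\ \mathsf{let}\,(l_2,x',n')=\mathrm{snoc}'(l_1,x,n)\ \mathsf{in}\ \mathsf{let}\ l_3=\mathrm{len}^{-1}(l_2,S(n'))\ \mathsf{in}\,(l_3,x')\}$. * $\mathrm{growth}=\{(l,r)\leftrightarrow\mathsf{let}\,(l',b_1)=\mathrm{snoc}(l,b^T)\ \mathsf{in}\ \mathsf{let}\,(r',b_2)=\mathrm{snoc}(r,b^T)\ \mathsf{in}\ \mathsf{let}\ l''=\mathrm{erase}_{b^T}(l',b_1)\ \mathsf{in}\ \mathsf{let}\ r''=\mathrm{erase}_{b^T}(r',b_2)\ \mathsf{in}\,(l'',r'')\}$, which appends $b^T$ at the end of both lists; $\mathrm{pad}=\{(q,(l,s,r))\leftrightarrow\mathsf{let}\,(l',r')=\mathrm{growth}(l,r)\ \mathsf{in}\,(q,(l',s,r'))\}$. * $\mathrm{isos}_{\mathbb B}(M): C^T\leftrightarrow C^T\otimes(\mathtt I\oplus\mathtt I)$ has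 one clause $(q^T,u)\leftrightarrow\mathsf{let}\,(l,r)=\mathrm{growth}(x',y')\ \mathsf{in}\,((q'^T,u'),\beta)$ for each rule $(q,a,q')$, where $\beta=\mathtt{ff}$ if $q'=q_f$ and $\beta=\mathtt{tt}$ otherwise, and $(u,u')$ is $((x',z,y::y'),(z::l,y,r))$ for $a=\rightarrow$, $((x::x',z,y'),(l,x,z::r))$ for $a=\leftarrow$, $((x',z,y'),(l,z,r))$ for $a=\downarrow$, and $((x',s^T,y'),(l,s'^T,r))$ for $a=(s,s')$. The iso $\mathrm{isos}_{\mathbb B}(M^{-1})$ is formed in the same way from $M^{-1}$, whose final state is $q_s$. * $\mathrm{It}=\lambda\psi.\mathsf{fix}\,\phi.\{x\leftrightarrow\mathsf{let}\ y=\psi\,x\ \mathsf{in}\ \mathsf{let}\ z=\{(y,\mathtt{tt})\leftrightarrow\mathsf{let}\,(z,n)=\phi\,y\ \mathsf{in}\,(z,S(n))\mid(y,\mathtt{ff})\leftrightarrow(y,0)\}\,y\ \mathsf{in}\ z\}$. * $\mathrm{rmBlank}=\mathsf{fix}\,\phi.\{[\,]\leftrightarrow([\,],0)\mid b^T::t\leftrightarrow\mathsf{let}\,(t',n)=\phi\,t\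 \mathsf{in}\,(t',S(n))\mid a^T::t\leftrightarrow(a^T::t,0)\ (a\in\Sigma\setminus\{b\})\}$. * $\mathrm{rev}=\{x\leftrightarrow\mathsf{let}\,(t_1,t_2)=\mathrm{rev}_{\mathrm{aux}}(x,[\,])\ \mathsf{in}\,(t_1,t_2)\}$ with $\mathrm{rev}_{\mathrm{aux}}=\mathsf{fix}\,\phi.\{([\,],y)\leftrightarrow([\,],y)\mid(h::t,y)\leftrightarrow\mathsf{let}\,(h_1,h_2)=\mathrm{Dup}\,h\ \mathsf{in}\ \mathsf{let}\,(t_1,t_2)=\phi(t,h_2::y)\ \mathsf{in}\,(h_1::t_1,t_2)\}$. * $\mathrm{cleanUp}=\{((x,(l,y,r)),n)\leftrightarrow\mathsf{let}\,(l',n_1)=\mathrm{rmBlank}\,l\ \mathsf{in}\ \mathsf{let}\,(r_o,r_v)=\mathrm{rev}\,r\ \mathsf{in}\ \mathsf{let}\,(r',n_2)=\mathrm{rmBlank}\,r_v\ \mathsf{in}\ \mathsf{let}\,(c,d)=\mathrm{rev}\,r'\ \mathsf{in}\ \mathsf{let}\ r''=\mathrm{rev}^{-1}(d,c)\ \mathsf{in}\,((x,(l',y,r'')),n,n_1,n_2,r_o)\}$.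 * For isos $\omega: A\leftrightarrow B\otimes G$ and $\omega': B\leftrightarrow A\otimes G'$, $\mathrm{GarRem}(\omega,\omega')=\{x_1\leftrightarrow\mathsf{let}\,(x_2,y)=\omega\,x_1\ \mathsf{in}\ \mathsf{let}\,(x_3,z)=\mathrm{Dup}_B\,x_2\ \mathsf{in}\ \mathsf{let}\ x_4=\omega^{-1}(x_3,y)\ \mathsf{in}\ \mathsf{let}\,(z_2,y_2)=\omega'\,z\ \mathsf{in}\ \mathsf{let}\ z_3=\mathrm{Dup}_A^{-1}(z_2,x_4)\ \mathsf{in}\ \mathsf{let}\ z_4=\omega'^{-1}(z_3,y_2)\ \mathsf{in}\ z_4\}$. Let $R_M=\{x\leftrightarrow\mathsf{let}\ w=\mathrm{pad}\,x\ \mathsf{in}\ \mathsf{let}\ y=(\mathrm{It}\ \mathrm{isos}_{\mathbb B}(M))\,w\ \mathsf{in}\ \mathsf{let}\ z=\mathrm{cleanUp}\,y\ \mathsf{in}\ z\}$, that is, $\mathrm{cleanUp}(\mathrm{It}(\mathrm{isos}_{\mathbb B}(M)))$ started on a tape with one blank supplied at each end. **Theorem (Capturing the exact semantics of an RTM).**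 Let $M$ be an RTM (with $q_s\ne q_f$), and let $C=(q_s,(\epsilon,b,s))$ and $C'=(q_f,(\epsilon,b,s'))$ be standard configurations, i.e. $s,s'\in(\Sigma\setminus\{b\})^*$, such that $M\vdash C\rightsquigarrow^* C'$. Then $$\mathrm{GarRem}(R_M,R_{M^{-1}})\ \mathrm{isos}(C)\ \to^*\ \mathrm{isos}(C').$$ -/

import Mathlib

/-! A reversible language with symmetric pattern-matching: syntax, inversion, reduction. -/

namespace RevLang

/-- Base types.  Type variables are de Bruijn indices, bound by `mu`. -/
inductive Ty : Type
  | one : Ty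
  | sum : Ty → Ty → Ty
  | tensor : Ty → Ty → Ty
  | mu : Ty → Ty
  | var : ℕ → Ty

/-- Values; term variables are natural numbers. -/
inductive Val : Type
  | unit : Val
  | var : ℕ → Val
  | inl : Val → Val
  | inr : Val → Val
  | pair : Val → Val → Val
  | fold : Val → Val

/-- Patterns `p ::= x ∣ p ⊗ p`. -/
inductive Pat : Type
  | var : ℕ → Pat
  | pair : Pat → Pat → Pat

mutual
/-- Isos.  Iso variables are de Bruijn indices, bound by `fix` and `lam`. -/
inductive Iso : Type
  | abs : Clauses → Iso
  | fix : Iso → Iso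
  | lam : Iso → Iso
  | var : ℕ → Iso
  | app : Iso → Iso → Iso
/-- The clauses `{ v₁ ↔ e₁ ∣ … ∣ vₙ ↔ eₙ }` of an iso abstraction. -/
inductive Clauses : Type
  | nil : Clauses
  | cons : Val → Expr → Clauses → Clauses
/-- Expressions: `letIn p₁ ω p₂ e` is `let p₁ = ω p₂ in e`. -/
inductive Expr : Type
  | val : Val → Expr
  | letIn : Pat → Iso → Pat → Expr → Expr
end

/-- Terms. -/
inductive Term : Type
  | unit : Term
  | var : ℕ → Term
  | inl : Term → Term
  | inr : Term → Term
  | pair : Term → Term → Term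
  | fold : Term → Term
  | app : Iso → Term → Term
  | letIn : Pat → Term → Term → Term

/-- Every pattern is a value. -/
def Pat.toVal : Pat → Val
  | .var x => .var x
  | .pair p q => .pair p.toVal q.toVal

/-- The variables of a pattern. -/
def Pat.vars : Pat → List ℕ
  | .var x => [x]
  | .pair p q => p.vars ++ q.vars

/-- Every value is a term. -/
def Val.toTerm : Val → Term
  | .unit => .unit
  | .var x => .var x
  | .inl v => .inl v.toTerm
  | .inr v => .inr v.toTerm
  | .pair v w => .pair v.toTerm w.toTerm
  | .fold v => .fold v.toTerm

/-- Every expression is a term. -/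
def Expr.toTerm : Expr → Term
  | .val v => v.toTerm
  | .letIn p₁ ω p₂ e => .letIn p₁ (.app ω p₂.toVal.toTerm) e.toTerm

/-- Membership of a clause in a list of clauses. -/
inductive Clauses.Mem (v : Val) (e : Expr) : Clauses → Prop
  | head (cs : Clauses) : Clauses.Mem v e (.cons v e cs)
  | tail (v' : Val) (e' : Expr) {cs : Clauses} :
      Clauses.Mem v e cs → Clauses.Mem v e (.cons v' e' cs)

/-! ### Substitution of isos for iso variables -/

mutual
/-- Increase by one every iso variable with index at least `k`. -/
def Iso.lift : Iso → ℕ → Iso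
  | .abs cs, k => .abs (cs.lift k)
  | .fix ω, k => .fix (ω.lift (k + 1))
  | .lam ω, k => .lam (ω.lift (k + 1))
  | .var i, k => if i < k then .var i else .var (i + 1)
  | .app ω₁ ω₂, k => .app (ω₁.lift k) (ω₂.lift k)
/-- Lifting in clauses. -/
def Clauses.lift : Clauses → ℕ → Clauses
  | .nil, _ => .nil
  | .cons v e cs, k => .cons v (e.lift k) (cs.lift k)
/-- Lifting in expressions. -/
def Expr.lift : Expr → ℕ → Expr
  | .val v, _ => .val v
  | .letIn p₁ ω p₂ e, k => .letIn p₁ (ω.lift k) p₂ (e.lift k)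
end

mutual
/-- `ω.subst k ω'` replaces the iso variable `k` of `ω` by `ω'`, whose free variables are those
outside the binder of `k`. -/
def Iso.subst : Iso → ℕ → Iso → Iso
  | .abs cs, k, ω' => .abs (cs.subst k ω')
  | .fix ω, k, ω' => .fix (ω.subst (k + 1) (ω'.lift 0))
  | .lam ω, k, ω' => .lam (ω.subst (k + 1) (ω'.lift 0))
  | .var i, k, ω' => if i < k then .var i else if i = k then ω' else .var (i - 1)
  | .app ω₁ ω₂, k, ω' => .app (ω₁.subst k ω') (ω₂.subst k ω')
/-- Substitution in clauses. -/
def Clauses.subst : Clauses → ℕ → Iso → Clauses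
  | .nil, _, _ => .nil
  | .cons v e cs, k, ω' => .cons v (e.subst k ω') (cs.subst k ω')
/-- Substitution in expressions. -/
def Expr.subst : Expr → ℕ → Iso → Expr
  | .val v, _, _ => .val v
  | .letIn p₁ ω p₂ e, k, ω' => .letIn p₁ (ω.subst k ω') p₂ (e.subst k ω')
end

/-! ### Inversion -/

/-- The value `v'` at the end of `let … in … in v'`. -/
def Expr.result : Expr → Val
  | .val v => v
  | .letIn _ _ _ e => e.result

mutual
/-- The inverse `ω⁻¹` of an iso. -/
def Iso.inv : Iso → Iso
  | .abs cs => .abs cs.inv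
  | .fix ω => .fix ω.inv
  | .lam ω => .lam ω.inv
  | .var i => .var i
  | .app ω₁ ω₂ => .app ω₁.inv ω₂.inv
/-- The clause `v ↔ let p₁ = ω₁ p₁' in … let pₙ = ωₙ pₙ' in v'` becomes
`v' ↔ let pₙ' = ωₙ⁻¹ pₙ in … let p₁' = ω₁⁻¹ p₁ in v`. -/
def Clauses.inv : Clauses → Clauses
  | .nil => .nil
  | .cons v e cs => .cons e.result (e.invAcc (.val v)) cs.inv
/-- The inverted `let`s of an expression, in reverse order, in front of `acc`. -/
def Expr.invAcc : Expr → Expr → Expr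
  | .val _, acc => acc
  | .letIn p₁ ω p₂ e, acc => e.invAcc (.letIn p₂ ω.inv p₁ acc)
end

/-! ### Operational semantics -/

/-- Small-step reduction of isos (call by name). -/
inductive Iso.Step : Iso → Iso → Prop
  | fix (ω : Iso) : Iso.Step (.fix ω) (ω.subst 0 (.fix ω))
  | beta (ω₁ ω₂ : Iso) : Iso.Step (.app (.lam ω₁) ω₂) (ω₁.subst 0 ω₂)
  | app {ω₁ ω₁' : Iso} (ω₂ : Iso) : Iso.Step ω₁ ω₁' → Iso.Step (.app ω₁ ω₂) (.app ω₁' ω₂)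

/-- Valuations: partial maps from term variables to values. -/
abbrev Valuation : Type := ℕ → Option Val

/-- The matching predicate `σ[v] = v'`: the value `v'` matches the value `v`, and `σ` is the
smallest valuation that witnesses it. -/
inductive Match : Valuation → Val → Val → Prop
  | unit : Match (fun _ => none) .unit .unit
  | var (x : ℕ) (v' : Val) : Match (fun y => if y = x then some v' else none) (.var x) v'
  | inl {σ : Valuation} {v v' : Val} : Match σ v v' → Match σ (.inl v) (.inl v')
  | inr {σ : Valuation} {v v' : Val} : Match σ v v' → Match σ (.inr v) (.inr v')
  | fold {σ : Valuation} {v v' : Val} : Match σ v v' → Match σ (.fold v) (.fold v')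
  | pair {σ₁ σ₂ : Valuation} {v₁ v₂ v₁' v₂' : Val} :
      Match σ₁ v₁ v₁' → Match σ₂ v₂ v₂' → (∀ x, σ₁ x = none ∨ σ₂ x = none) →
      Match (fun x => (σ₁ x).or (σ₂ x)) (.pair v₁ v₂) (.pair v₁' v₂')

/-- Application `σ(t)` of a valuation to a term.  Isos have no free term variables, and the
variables bound by a `let` are not substituted in its body. -/
def Term.subst (σ : Valuation) : Term → Term
  | .unit => .unit
  | .var x => ((σ x).map Val.toTerm).getD (.var x)
  | .inl t => .inl (t.subst σ)
  | .inr t => .inr (t.subst σ)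
  | .pair t₁ t₂ => .pair (t₁.subst σ) (t₂.subst σ)
  | .fold t => .fold (t.subst σ)
  | .app ω t => .app ω (t.subst σ)
  | .letIn p t₁ t₂ =>
      .letIn p (t₁.subst σ) (t₂.subst (fun x => if x ∈ p.vars then none else σ x))

/-- Small-step reduction of terms (call by value). -/
inductive Term.Step : Term → Term → Prop
  | clause {cs : Clauses} {v v' : Val} {e : Expr} {σ : Valuation} :
      cs.Mem v e → Match σ v v' → Term.Step (.app (.abs cs) v'.toTerm) (e.toTerm.subst σ)
  | letVal {p : Pat} {v : Val} {σ : Valuation} (t : Term) :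
      Match σ p.toVal v → Term.Step (.letIn p v.toTerm t) (t.subst σ)
  | iso {ω ω' : Iso} (t : Term) : Iso.Step ω ω' → Term.Step (.app ω t) (.app ω' t)
  | inl {t t' : Term} : Term.Step t t' → Term.Step (.inl t) (.inl t')
  | inr {t t' : Term} : Term.Step t t' → Term.Step (.inr t) (.inr t')
  | fold {t t' : Term} : Term.Step t t' → Term.Step (.fold t) (.fold t')
  | pairLeft {t t' : Term} (u : Term) : Term.Step t t' → Term.Step (.pair t u) (.pair t' u)
  | pairRight {t t' : Term} (v : Val) :
      Term.Step t t' → Term.Step (.pair v.toTerm t) (.pair v.toTerm t')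
  | arg (cs : Clauses) {t t' : Term} :
      Term.Step t t' → Term.Step (.app (.abs cs) t) (.app (.abs cs) t')
  | letArg (p : Pat) {t t' : Term} (u : Term) :
      Term.Step t t' → Term.Step (.letIn p t u) (.letIn p t' u)

/-- `t →* t'`. -/
def Term.Reduces : Term → Term → Prop := Relation.ReflTransGen Term.Step

/-! ### Notational helpers -/

/-- A list of clauses as an iso abstraction. -/
def Clauses.ofList : List (Val × Expr) → Clauses
  | [] => .nil
  | c :: cs => .cons c.1 c.2 (Clauses.ofList cs)

/-- The iso abstraction with the given clauses. -/
def Iso.mk (cs : List (Val × Expr)) : Iso := .abs (Clauses.ofList cs)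

/-- The type `[A] = μ X. I ⊕ (A ⊗ X)`, for `A` closed. -/
def Ty.list (A : Ty) : Ty := .mu (.sum .one (.tensor A (.var 0)))

/-- The value `0` of type `nat = μ X. I ⊕ X`. -/
def Val.zero : Val := .fold (.inl .unit)
/-- The value `S(v)`. -/
def Val.succ (v : Val) : Val := .fold (.inr v)
/-- The empty list. -/
def Val.nil : Val := .fold (.inl .unit)
/-- The list `h :: t`. -/
def Val.cons (h t : Val) : Val := .fold (.inr (.pair h t))
/-- The list with the given entries. -/
def Val.ofList : List Val → Val
  | [] => .nil
  | v :: vs => .cons v (Val.ofList vs)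
/-- The boolean `tt` of type `I ⊕ I`. -/
def Val.tt : Val := .inl .unit
/-- The boolean `ff` of type `I ⊕ I`. -/
def Val.ff : Val := .inr .unit

/-- The sum `I ⊕ (I ⊕ ⋯)` of `n` copies of `I`. -/
def Ty.finSum : ℕ → Ty
  | 0 => .one
  | 1 => .one
  | n + 2 => .sum .one (Ty.finSum (n + 1))

/-- The closed value of type `Ty.finSum n` that encodes its summand number `i < n`. -/
def Val.finInj : ℕ → ℕ → Val
  | 0, _ => .unit
  | 1, _ => .unit
  | _ + 2, 0 => .inl .unit
  | n + 2, i + 1 => .inr (Val.finInj (n + 1) i)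

/-! ### Duplication and auxiliary isos -/

/-- The duplication iso `A ↔ A ⊗ A`.  In the scope of `k` binders `mu`, the type variable `i` stands
for the recursive type bound there and is duplicated by the iso variable `i` of the corresponding
`fix`; for closed `A` this is the iso obtained by unfolding `μ X. A` into `A[μ X. A / X]` and
calling the `fix` variable at the inner occurrences of `μ X. A`. -/
def dup : Ty → Iso
  | .one => .mk [(.unit, .val (.pair .unit .unit))]
  | .tensor A B => .mk
      [(.pair (.var 0) (.var 1),
        .letIn (.pair (.var 2) (.var 3)) (dup A) (.var 0) <|
        .letIn (.pair (.var 4) (.var 5)) (dup B) (.var 1) <|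
        .val (.pair (.pair (.var 2) (.var 4)) (.pair (.var 3) (.var 5))))]
  | .sum A B => .mk
      [(.inl (.var 0),
        .letIn (.pair (.var 1) (.var 2)) (dup A) (.var 0) <|
        .val (.pair (.inl (.var 1)) (.inl (.var 2)))),
       (.inr (.var 0),
        .letIn (.pair (.var 1) (.var 2)) (dup B) (.var 0) <|
        .val (.pair (.inr (.var 1)) (.inr (.var 2))))]
  | .mu A => .fix <| .mk
      [(.fold (.var 0),
        .letIn (.pair (.var 1) (.var 2)) (dup A) (.var 0) <|
        .val (.pair (.fold (.var 1)) (.fold (.var 2))))]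
  | .var i => .mk
      [(.var 0,
        .letIn (.pair (.var 1) (.var 2)) (.var i) (.var 0) <|
        .val (.pair (.var 1) (.var 2)))]

/-- `erase_v = { (x, v) ↔ x }`; its inverse maps `x` to `(x, v)`. -/
def erase (v : Val) : Iso := .mk [(.pair (.var 0) v, .val (.var 0))]

/-- `{ x ↔ S(x) }`. -/
def succIso : Iso := .mk [(.var 0, .val (.succ (.var 0)))]

/-- `{ (h, t) ↔ h :: t }`. -/
def consIso : Iso := .mk [(.pair (.var 0) (.var 1), .val (.cons (.var 0) (.var 1)))]

/-- `len : [A] ↔ [A] ⊗ nat`. -/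
def len : Iso := .fix <| .mk
  [(.nil, .val (.pair .nil .zero)),
   (.cons (.var 0) (.var 1),
    .letIn (.pair (.var 2) (.var 3)) (.var 0) (.var 1) <|
    .val (.pair (.cons (.var 0) (.var 2)) (.succ (.var 3))))]

/-- `snoc' : [A] ⊗ A ⊗ nat ↔ [A] ⊗ A ⊗ nat`, for `A` closed: it maps `([v₁, …, vₙ], v, n)` to
`([v₁, …, vₙ, v], v, n)`. -/
def snoc' (A : Ty) : Iso := .fix <| .mk
  [(.pair .nil (.pair (.var 0) .zero),
    .letIn (.pair (.var 1) (.var 2)) (dup A) (.var 0) <|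
    .val (.pair (.cons (.var 1) .nil) (.pair (.var 2) .zero))),
   (.pair (.cons (.var 0) (.var 1)) (.pair (.var 2) (.succ (.var 3))),
    .letIn (.pair (.var 4) (.pair (.var 5) (.var 6))) (.var 0)
      (.pair (.var 1) (.pair (.var 2) (.var 3))) <|
    .val (.pair (.cons (.var 0) (.var 4)) (.pair (.var 5) (.succ (.var 6)))))]

/-- `snoc : [A] ⊗ A ↔ [A] ⊗ A`: it maps `([v₁, …, vₙ], v)` to `([v₁, …, vₙ, v], v)`. -/
def snoc (A : Ty) : Iso := .mk
  [(.pair (.var 0) (.var 1),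
    .letIn (.pair (.var 2) (.var 3)) len (.var 0) <|
    .letIn (.pair (.var 4) (.pair (.var 5) (.var 6))) (snoc' A)
      (.pair (.var 2) (.pair (.var 1) (.var 3))) <|
    .letIn (.var 7) succIso (.var 6) <|
    .letIn (.var 8) len.inv (.pair (.var 4) (.var 7)) <|
    .val (.pair (.var 8) (.var 5)))]

/-- `growth : [A] ⊗ [A] ↔ [A] ⊗ [A]` appends the value `b` at the end of both lists. -/
def growth (A : Ty) (b : Val) : Iso := .mk
  [(.pair (.var 0) (.var 1),
    .letIn (.var 2) (erase b).inv (.var 0) <|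
    .letIn (.pair (.var 3) (.var 4)) (snoc A) (.var 2) <|
    .letIn (.var 5) (erase b).inv (.var 1) <|
    .letIn (.pair (.var 6) (.var 7)) (snoc A) (.var 5) <|
    .letIn (.var 8) (erase b) (.pair (.var 3) (.var 4)) <|
    .letIn (.var 9) (erase b) (.pair (.var 6) (.var 7)) <|
    .val (.pair (.var 8) (.var 9)))]

/-- `It : (A ↔ A ⊗ (I ⊕ I)) → (A ↔ A ⊗ nat)` iterates its argument `ψ` until `ff` is met and counts
the iterations.  Inside, `ψ` is the iso variable `1` and the recursive call `It ψ` is `0`. -/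
def iter : Iso := .lam <| .fix <| .mk
  [(.var 0,
    .letIn (.var 1) (.var 1) (.var 0) <|
    .letIn (.var 2)
      (.mk
        [(.pair (.var 0) .tt,
          .letIn (.pair (.var 1) (.var 2)) (.var 0) (.var 0) <|
          .val (.pair (.var 1) (.succ (.var 2)))),
         (.pair (.var 0) .ff, .val (.pair (.var 0) .zero))])
      (.var 1) <|
    .val (.var 2))]

/-- `rmBlank : [A] ↔ [A] ⊗ nat` removes and counts the values `b` at the beginning of a list, where
`as` is the list of the other values of the (finite) type `A`. -/
def rmBlank (b : Val) (as : List Val) : Iso := .fix <| .mk <|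
  (.nil, .val (.pair .nil .zero)) ::
  (.cons b (.var 0),
    .letIn (.pair (.var 1) (.var 2)) (.var 0) (.var 0) <|
    .val (.pair (.var 1) (.succ (.var 2)))) ::
  as.map fun a => (.cons a (.var 0), .val (.pair (.cons a (.var 0)) .zero))

/-- `rev_aux : [A] ⊗ [A] ↔ [A] ⊗ [A]`, for `A` closed. -/
def revAux (A : Ty) : Iso := .fix <| .mk
  [(.pair .nil (.var 0), .val (.pair .nil (.var 0))),
   (.pair (.cons (.var 0) (.var 1)) (.var 2),
    .letIn (.pair (.var 3) (.var 4)) (dup A) (.var 0) <|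
    .letIn (.var 5) consIso (.pair (.var 4) (.var 2)) <|
    .letIn (.pair (.var 6) (.var 7)) (.var 0) (.pair (.var 1) (.var 5)) <|
    .val (.pair (.cons (.var 3) (.var 6)) (.var 7)))]

/-- `rev : [A] ↔ [A] ⊗ [A]` maps a list to the pair of that list and its reversal. -/
def rev (A : Ty) : Iso := .mk
  [(.var 0,
    .letIn (.var 1) (erase .nil).inv (.var 0) <|
    .letIn (.pair (.var 2) (.var 3)) (revAux A) (.var 1) <|
    .val (.pair (.var 2) (.var 3)))]

/-- `cleanUp : (Q ⊗ ([A] ⊗ A ⊗ [A])) ⊗ nat ↔ (Q ⊗ ([A] ⊗ A ⊗ [A])) ⊗ nat ⊗ nat ⊗ nat ⊗ [A]`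
removes the values `b` at the beginning of the left list and at the end of the right list.  The
right list is reversed, stripped, and reversed back: `rev` maps `r'` to `(r', r'')` with `r''` the
reversal of `r'`, and as `r'` is also the reversal of `r''`, `rev⁻¹` maps `(r'', r')` to `r''`. -/
def cleanUp (A : Ty) (b : Val) (as : List Val) : Iso := .mk
  [(.pair (.pair (.var 0) (.pair (.var 1) (.pair (.var 2) (.var 3)))) (.var 4),
    .letIn (.pair (.var 5) (.var 6)) (rmBlank b as) (.var 1) <|
    .letIn (.pair (.var 7) (.var 8)) (rev A) (.var 3) <|
    .letIn (.pair (.var 9) (.var 10)) (rmBlank b as) (.var 8) <|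
    .letIn (.pair (.var 11) (.var 12)) (rev A) (.var 9) <|
    .letIn (.var 13) (rev A).inv (.pair (.var 12) (.var 11)) <|
    .val (.pair (.pair (.var 0) (.pair (.var 5) (.pair (.var 2) (.var 13))))
      (.pair (.var 4) (.pair (.var 6) (.pair (.var 10) (.var 7))))))]

/-- Garbage removal: from `ω : A ↔ B ⊗ C` and `ω' : B ↔ A ⊗ C'`, an iso `A ↔ B`. -/
def garRem (A B : Ty) (ω ω' : Iso) : Iso := .mk
  [(.var 0,
    .letIn (.pair (.var 1) (.var 2)) ω (.var 0) <|
    .letIn (.pair (.var 3) (.var 4)) (dup B) (.var 1) <|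
    .letIn (.var 5) ω.inv (.pair (.var 3) (.var 2)) <|
    .letIn (.pair (.var 6) (.var 7)) ω' (.var 4) <|
    .letIn (.var 8) (dup A).inv (.pair (.var 6) (.var 5)) <|
    .letIn (.var 9) ω'.inv (.pair (.var 8) (.var 7)) <|
    .val (.var 9))]

end RevLang

/-! Reversible Turing machines and their encoding. -/

namespace RTM

/-- The action of a transition rule: rewrite the scanned symbol `s` into `s'`, move the head one
cell to the left, do not move, or move the head one cell to the right. -/
inductive Act (Γ : Type*) : Type _
  | write : Γ → Γ → Act Γ
  | left : Act Γ
  | stay : Act Γ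
  | right : Act Γ

/-- A Turing machine in triple format, with transition relation `δ`, start state and final state.
The blank symbol is the distinguished element `default` of the alphabet `Γ`. -/
structure Machine (Q Γ : Type*) where
  δ : Finset (Q × Act Γ × Q)
  qs : Q
  qf : Q

/-- `M` is a reversible Turing machine. -/
structure Machine.IsReversible {Q Γ : Type*} (M : Machine Q Γ) : Prop where
  no_rule_from_qf : ∀ a q', (M.qf, a, q') ∉ M.δ
  no_rule_into_qs : ∀ q a, (q, a, M.qs) ∉ M.δ
  forward : ∀ q a₁ q₁' a₂ q₂', (q, a₁, q₁') ∈ M.δ → (q, a₂, q₂') ∈ M.δ →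
    (a₁, q₁') ≠ (a₂, q₂') →
    ∃ s₁ s₁' s₂ s₂', a₁ = .write s₁ s₁' ∧ a₂ = .write s₂ s₂' ∧ s₁ ≠ s₂
  backward : ∀ q₁ a₁ q₂ a₂ q', (q₁, a₁, q') ∈ M.δ → (q₂, a₂, q') ∈ M.δ →
    (q₁, a₁) ≠ (q₂, a₂) →
    ∃ s₁ s₁' s₂ s₂', a₁ = .write s₁ s₁' ∧ a₂ = .write s₂ s₂' ∧ s₁' ≠ s₂'

/-- The inverse action. -/
def Act.inv {Γ : Type*} : Act Γ → Act Γ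
  | .write s s' => .write s' s
  | .left => .right
  | .stay => .stay
  | .right => .left

theorem Act.inv_inv {Γ : Type*} (a : Act Γ) : a.inv.inv = a := by
  cases a <;> rfl

/-- The inverse rule. -/
def ruleInv {Q Γ : Type*} (t : Q × Act Γ × Q) : Q × Act Γ × Q := (t.2.2, t.2.1.inv, t.1)

theorem ruleInv_injective {Q Γ : Type*} : Function.Injective (ruleInv (Q := Q) (Γ := Γ)) :=
  Function.Involutive.injective fun t => by simp [ruleInv, Act.inv_inv]

/-- The inverse machine `M⁻¹`: all rules are inverted, start and final state are exchanged. -/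
def Machine.inv {Q Γ : Type*} (M : Machine Q Γ) : Machine Q Γ where
  δ := M.δ.map ⟨ruleInv, ruleInv_injective⟩
  qs := M.qf
  qf := M.qs

/-- A configuration `(q, (l, s, r))`: state, left part of the tape (read from left to right), scanned
symbol, right part of the tape (read from left to right). -/
structure Conf (Q Γ : Type*) where
  state : Q
  l : List Γ
  s : Γ
  r : List Γ

/-- The two-way infinite tape of a configuration: the strings `l` and `r` are continued by blanks
on both sides. -/
def Conf.tape {Q Γ : Type*} [Inhabited Γ] (C : Conf Q Γ) : Turing.Tape Γ :=
  ⟨C.s, Turing.ListBlank.mk C.l.reverse, Turing.ListBlank.mk C.r⟩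

/-- The effect of an action on a tape. -/
def Act.Rel {Γ : Type*} [Inhabited Γ] : Act Γ → Turing.Tape Γ → Turing.Tape Γ → Prop
  | .write s s', T, T' => T.head = s ∧ T' = T.write s'
  | .left, T, T' => T' = T.move .left
  | .stay, T, T' => T' = T
  | .right, T, T' => T' = T.move .right

/-- `M ⊢ C ⇝ C'`: one computation step, where strings that differ only by blanks at the outer ends
denote the same tape. -/
def Machine.Step {Q Γ : Type*} [Inhabited Γ] (M : Machine Q Γ) (C C' : Conf Q Γ) : Prop :=
  ∃ a, (C.state, a, C'.state) ∈ M.δ ∧ a.Rel C.tape C'.tape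

/-- `M ⊢ C ⇝* C'`. -/
def Machine.Steps {Q Γ : Type*} [Inhabited Γ] (M : Machine Q Γ) : Conf Q Γ → Conf Q Γ → Prop :=
  Relation.ReflTransGen M.Step

/-- The configuration `(q, (ε, b, w))`; it is standard if `w` is blank-free. -/
def Conf.standard {Q Γ : Type*} [Inhabited Γ] (q : Q) (w : List Γ) : Conf Q Γ :=
  ⟨q, [], default, w⟩

/-! ### Encoding -/

open RevLang

/-- The encoding of an element of a finite set, enumerated by `e`, in `I ⊕ ⋯ ⊕ I`. -/
def enc {X : Type*} {n : ℕ} (e : X ≃ Fin n) (x : X) : Val := Val.finInj n (e x)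

/-- The type `Q ⊗ ([Γ] ⊗ Γ ⊗ [Γ])` of configurations, for `n` states and `m` symbols. -/
def confTy (n m : ℕ) : Ty :=
  .tensor (.finSum n) (.tensor (.list (.finSum m)) (.tensor (.finSum m) (.list (.finSum m))))

/-- The closed value `isos(C)` that encodes a configuration.  Both halves of the tape are lists that
start next to the head. -/
def Conf.isos {Q Γ : Type*} {n m : ℕ} (eQ : Q ≃ Fin n) (eΓ : Γ ≃ Fin m) (C : Conf Q Γ) : Val :=
  .pair (enc eQ C.state)
    (.pair (Val.ofList (C.l.reverse.map (enc eΓ)))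
      (.pair (enc eΓ C.s) (Val.ofList (C.r.map (enc eΓ)))))

/-- `growth` for the blank symbol. -/
def growthIso {Γ : Type*} [Inhabited Γ] {m : ℕ} (eΓ : Γ ≃ Fin m) : Iso :=
  growth (.finSum m) (enc eΓ default)

/-- The clause that encodes a rule `(q, a, q')`, with the additional boolean `halted` in its output:
* `→`: `(q, (x, z, y :: y')) ↔ let (l, r) = growth (x, y') in ((q', (z :: l, y, r)), halted)`;
* `←`: `(q, (y :: x, z, y')) ↔ let (l, r) = growth (x, y') in ((q', (l, y, z :: r)), halted)`;
* `↓`: `(q, (x, z, y')) ↔ let (l, r) = growth (x, y') in ((q', (l, z, r)), halted)`;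
* `(s, s')`: `(q, (x, s, y')) ↔ let (l, r) = growth (x, y') in ((q', (l, s', r)), halted)`.

Here `x = 0`, `y' = 1`, `z = 2`, `y = 3`, `l = 4`, `r = 5`. -/
def ruleClause {Q Γ : Type*} [Inhabited Γ] {n m : ℕ} (eQ : Q ≃ Fin n) (eΓ : Γ ≃ Fin m)
    (t : Q × Act Γ × Q) (halted : Val) : Val × Expr :=
  let grow (v : Val) : Expr :=
    .letIn (.pair (.var 4) (.var 5)) (growthIso eΓ) (.pair (.var 0) (.var 1)) <|
    .val (.pair (.pair (enc eQ t.2.2) v) halted)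
  match t.2.1 with
  | .right =>
      (.pair (enc eQ t.1) (.pair (.var 0) (.pair (.var 2) (.cons (.var 3) (.var 1)))),
        grow (.pair (.cons (.var 2) (.var 4)) (.pair (.var 3) (.var 5))))
  | .left =>
      (.pair (enc eQ t.1) (.pair (.cons (.var 3) (.var 0)) (.pair (.var 2) (.var 1))),
        grow (.pair (.var 4) (.pair (.var 3) (.cons (.var 2) (.var 5)))))
  | .stay =>
      (.pair (enc eQ t.1) (.pair (.var 0) (.pair (.var 2) (.var 1))),
        grow (.pair (.var 4) (.pair (.var 2) (.var 5))))
  | .write s s' =>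
      (.pair (enc eQ t.1) (.pair (.var 0) (.pair (enc eΓ s) (.var 1))),
        grow (.pair (.var 4) (.pair (enc eΓ s') (.var 5))))

/-- The iso with one clause for each rule of a list; the boolean is `ff` if the new state is `qf`,
and `tt` otherwise. -/
def rulesIso {Q Γ : Type*} [DecidableEq Q] [Inhabited Γ] {n m : ℕ} (eQ : Q ≃ Fin n)
    (eΓ : Γ ≃ Fin m) (qf : Q) (δ : List (Q × Act Γ × Q)) : Iso :=
  .mk (δ.map fun t => ruleClause eQ eΓ t (if t.2.2 = qf then .ff else .tt))

/-- `isos_𝔹(M) : Conf ↔ Conf ⊗ (I ⊕ I)`. -/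
noncomputable def Machine.isosB {Q Γ : Type*} [DecidableEq Q] [Inhabited Γ] {n m : ℕ}
    (eQ : Q ≃ Fin n) (eΓ : Γ ≃ Fin m) (M : Machine Q Γ) : Iso :=
  rulesIso eQ eΓ M.qf M.δ.toList

/-- `{ (q, (l, s, r)) ↔ let (l', r') = growth (l, r) in (q, (l', s, r')) }`: supplies one blank cell
at both ends of the tape. -/
def padIso {Γ : Type*} [Inhabited Γ] {m : ℕ} (eΓ : Γ ≃ Fin m) : Iso := .mk
  [(.pair (.var 0) (.pair (.var 1) (.pair (.var 2) (.var 3))),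
    .letIn (.pair (.var 4) (.var 5)) (growthIso eΓ) (.pair (.var 1) (.var 3)) <|
    .val (.pair (.var 0) (.pair (.var 4) (.pair (.var 2) (.var 5)))))]

/-- The list of the encodings of the non-blank symbols. -/
def nonBlanks {Γ : Type*} [Inhabited Γ] {m : ℕ} (eΓ : Γ ≃ Fin m) : List Val :=
  ((List.finRange m).filter (fun i => i ≠ eΓ default)).map fun i => enc eΓ (eΓ.symm i)

/-- `cleanUp (It ω)`, started on a tape with one blank cell supplied at both ends:
`{ x ↔ let w = pad x in let y = (It ω) w in let z = cleanUp y in z }`. -/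
def cleanUpIt {Γ : Type*} [Inhabited Γ] {m : ℕ} (eΓ : Γ ≃ Fin m) (ω : Iso) : Iso := .mk
  [(.var 0,
    .letIn (.var 1) (padIso eΓ) (.var 0) <|
    .letIn (.var 2) (.app iter ω) (.var 1) <|
    .letIn (.var 3) (cleanUp (.finSum m) (enc eΓ default) (nonBlanks eΓ)) (.var 2) <|
    .val (.var 3))]

end RTM

/-! ### A symmetric big-step semantics -/

namespace RevLang

-- The reduction is not symmetric, but the language is: a clause and its inverse contain the same
-- variables and the same equations between them. `Big ω a b` exploits this. A single closed
-- environment gives values to all variables of a clause, and every `let` has to hold in it.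
-- Inverting a clause keeps the environment and reverses the `let`s, so `Big ω a b` gives `Big ω⁻¹ b
-- a` (`Big.inv`). Conversely, scoping and linearity make such an environment a recipe for an actual
-- reduction (`Big.reduces`). Since any matching clause may fire, exhibiting one environment
-- suffices, and every use of an inverse iso comes for free.
--
-- On the machine side, the half tapes held by the iso need only represent the true tape up to outer
-- blanks. Each rule clause adds a blank at both ends, so both lists stay nonempty and a head move
-- always finds a cell (`exists_big_rulesIso`). The iteration stops exactly at the final state
-- (`exists_big_iterFix`). There the lists are the standard ones followed by blanks, which `cleanUp`
-- removes into the garbage (`exists_big_cleanUpIt`). As `M⁻¹` runs from `C'` back to `C`, the same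
-- argument applies to it.
--
-- Thus `R_M` maps `a` to `(b, g)` and `R_{M⁻¹}` maps `b` to `(a, g')`. `big_garRem` duplicates `b`,
-- uses one copy and `g` to recover `a`, sends the other to `(a, g')`, merges the two copies of `a`,
-- and runs `R_{M⁻¹}` backwards to obtain `b`.

/-- The variables of a value. -/
def Val.vars : Val → List ℕ
  | .unit => []
  | .var x => [x]
  | .inl v => v.vars
  | .inr v => v.vars
  | .pair v w => v.vars ++ w.vars
  | .fold v => v.vars

/-- Application of a total environment to a value. -/
def Val.bind (E : ℕ → Val) : Val → Val
  | .unit => .unit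
  | .var x => E x
  | .inl v => .inl (v.bind E)
  | .inr v => .inr (v.bind E)
  | .pair v w => .pair (v.bind E) (w.bind E)
  | .fold v => .fold (v.bind E)

/-- A value without variables. -/
def Val.Closed (v : Val) : Prop := v.vars = []

@[simp] theorem Val.closed_unit : Val.unit.Closed := rfl

@[simp] theorem Val.closed_inl {v : Val} : v.inl.Closed ↔ v.Closed := Iff.rfl

@[simp] theorem Val.closed_inr {v : Val} : v.inr.Closed ↔ v.Closed := Iff.rfl

@[simp] theorem Val.closed_fold {v : Val} : v.fold.Closed ↔ v.Closed := Iff.rfl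

@[simp] theorem Val.closed_pair {v w : Val} : (v.pair w).Closed ↔ v.Closed ∧ w.Closed := by
  simp [Val.Closed, Val.vars]

theorem Val.Closed.bind {v : Val} (h : v.Closed) (E : ℕ → Val) : v.bind E = v := by
  induction v with
  | unit => rfl
  | var x => simp [Val.Closed, Val.vars] at h
  | inl v ih => simpa [Val.bind] using ih h
  | inr v ih => simpa [Val.bind] using ih h
  | fold v ih => simpa [Val.bind] using ih h
  | pair v w ihv ihw =>
    rw [Val.closed_pair] at h
    simp [Val.bind, ihv h.1, ihw h.2]

theorem Val.Closed.subst_toTerm {v : Val} (h : v.Closed) (σ : Valuation) :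
    v.toTerm.subst σ = v.toTerm := by
  induction v with
  | unit => rfl
  | var x => simp [Val.Closed, Val.vars] at h
  | inl v ih => simpa [Val.toTerm, Term.subst] using ih h
  | inr v ih => simpa [Val.toTerm, Term.subst] using ih h
  | fold v ih => simpa [Val.toTerm, Term.subst] using ih h
  | pair v w ihv ihw =>
    rw [Val.closed_pair] at h
    simp [Val.toTerm, Term.subst, ihv h.1, ihw h.2]

theorem Pat.vars_toVal (p : Pat) : p.toVal.vars = p.vars := by
  induction p with
  | var x => rfl
  | pair p q ihp ihq => simp [Pat.toVal, Val.vars, Pat.vars, ihp, ihq]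

/-- The `let`s of an expression. -/
def Expr.lets : Expr → List (Pat × Iso × Pat)
  | .val _ => []
  | .letIn p₁ ω p₂ e => (p₁, ω, p₂) :: e.lets

/-- Starting with the variables `S`, every `let` uses variables in scope and binds a linear pattern,
and the variables `r` are in scope at the end. -/
def InScope : List ℕ → List (Pat × Pat) → List ℕ → Prop
  | S, [], r => r ⊆ S
  | S, (p₁, p₂) :: ls, r => p₂.vars ⊆ S ∧ p₁.vars.Nodup ∧ InScope (p₁.vars ++ S) ls r

/-- The patterns of the `let`s of an expression. -/
def Expr.letPats (e : Expr) : List (Pat × Pat) := e.lets.map fun t => (t.1, t.2.2)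

/-- A clause that is well scoped when it is read in either direction. -/
structure WellScoped (v : Val) (e : Expr) : Prop where
  left_nodup : v.vars.Nodup
  forward : InScope v.vars e.letPats e.result.vars
  right_nodup : e.result.vars.Nodup
  backward : InScope e.result.vars (e.letPats.map Prod.swap).reverse v.vars

/-- `Big ω a b`: the iso `ω` maps the closed value `a` to `b`.  For a clause this is witnessed by a
single environment for all its variables, so that the relation is symmetric under inversion. -/
inductive Big : Iso → Val → Val → Prop
  | abs {cs : Clauses} {v : Val} {e : Expr} (E : ℕ → Val) :
      (∀ x, (E x).Closed) → cs.Mem v e → WellScoped v e →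
      (∀ t ∈ e.lets, Big t.2.1 (t.2.2.toVal.bind E) (t.1.toVal.bind E)) →
      Big (.abs cs) (v.bind E) (e.result.bind E)
  | step {ω ω' : Iso} {a b : Val} : Iso.Step ω ω' → Big ω' a b → Big ω a b

/-! #### Inversion -/

theorem Expr.result_invAcc (e acc : Expr) : (e.invAcc acc).result = acc.result := by
  match e with
  | .val v => rfl
  | .letIn p₁ ω p₂ e => exact (Expr.result_invAcc e _).trans rfl

/-- `Big.abs` sees the `let`s only through membership in `lets`, so the reversal of their order
affects nothing but scoping. -/
theorem Expr.lets_invAcc (e acc : Expr) : (e.invAcc acc).lets =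
    (e.lets.map fun t => (t.2.2, t.2.1.inv, t.1)).reverse ++ acc.lets := by
  match e with
  | .val v => rfl
  | .letIn p₁ ω p₂ e =>
    rw [Expr.invAcc, Expr.lets_invAcc e]
    simp [Expr.lets]

theorem Clauses.Mem.inv {v : Val} {e : Expr} {cs : Clauses} (h : cs.Mem v e) :
    cs.inv.Mem e.result (e.invAcc (.val v)) := by
  induction h with
  | head cs => exact .head _
  | tail v' e' _ ih => exact .tail _ _ ih

mutual
-- Needed below the binders in `Iso.inv_subst`, where the substituted iso is lifted.
theorem Iso.inv_lift (ω : Iso) (k : ℕ) : (ω.lift k).inv = ω.inv.lift k := by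
  match ω with
  | .abs cs => simp [Iso.lift, Iso.inv, Clauses.inv_lift cs k]
  | .fix ω => simp [Iso.lift, Iso.inv, Iso.inv_lift ω]
  | .lam ω => simp [Iso.lift, Iso.inv, Iso.inv_lift ω]
  | .var i => simp only [Iso.lift, Iso.inv]; split <;> rfl
  | .app ω₁ ω₂ => simp [Iso.lift, Iso.inv, Iso.inv_lift ω₁, Iso.inv_lift ω₂]
theorem Clauses.inv_lift (cs : Clauses) (k : ℕ) : (cs.lift k).inv = cs.inv.lift k := by
  match cs with
  | .nil => rfl
  | .cons v e cs =>
    simp [Clauses.lift, Clauses.inv, Clauses.inv_lift cs k, Expr.result_lift e,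
      ← Expr.invAcc_lift e, Expr.lift]
theorem Expr.invAcc_lift (e : Expr) (acc : Expr) (k : ℕ) :
    (e.lift k).invAcc (acc.lift k) = (e.invAcc acc).lift k := by
  match e with
  | .val v => rfl
  | .letIn p₁ ω p₂ e =>
    simp [Expr.lift, Expr.invAcc, ← Expr.invAcc_lift e, Iso.inv_lift ω]
theorem Expr.result_lift (e : Expr) (k : ℕ) : (e.lift k).result = e.result := by
  match e with
  | .val v => rfl
  | .letIn p₁ ω p₂ e => simp [Expr.lift, Expr.result, Expr.result_lift e]
end

theorem Expr.result_subst (e : Expr) (k : ℕ) (ω : Iso) : (e.subst k ω).result = e.result := by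
  match e with
  | .val v => rfl
  | .letIn p₁ _ p₂ e => simp [Expr.subst, Expr.result, Expr.result_subst e]

mutual
-- Inversion keeps iso variables in place, so what replaces them only has to be inverted too. This
-- makes unfolding of `fix` and β-reduction compatible with inversion.
theorem Iso.inv_subst (ω : Iso) (k : ℕ) (ω' : Iso) :
    (ω.subst k ω').inv = ω.inv.subst k ω'.inv := by
  match ω with
  | .abs cs => simp [Iso.subst, Iso.inv, Clauses.inv_subst cs k]
  | .fix ω => simp [Iso.subst, Iso.inv, Iso.inv_subst ω, Iso.inv_lift]
  | .lam ω => simp [Iso.subst, Iso.inv, Iso.inv_subst ω, Iso.inv_lift]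
  | .var i => simp only [Iso.subst, Iso.inv]; split_ifs <;> rfl
  | .app ω₁ ω₂ => simp [Iso.subst, Iso.inv, Iso.inv_subst ω₁, Iso.inv_subst ω₂]
theorem Clauses.inv_subst (cs : Clauses) (k : ℕ) (ω' : Iso) :
    (cs.subst k ω').inv = cs.inv.subst k ω'.inv := by
  match cs with
  | .nil => rfl
  | .cons v e cs =>
    simp [Clauses.subst, Clauses.inv, Clauses.inv_subst cs k, Expr.result_subst e,
      ← Expr.invAcc_subst e, Expr.subst]
-- The accumulator consists of `let`s that are already inverted, hence receives `ω'.inv`, while `e`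
-- still receives `ω'`.
theorem Expr.invAcc_subst (e : Expr) (acc : Expr) (k : ℕ) (ω' : Iso) :
    (e.subst k ω').invAcc (acc.subst k ω'.inv) = (e.invAcc acc).subst k ω'.inv := by
  match e with
  | .val v => rfl
  | .letIn p₁ ω p₂ e =>
    simp [Expr.subst, Expr.invAcc, ← Expr.invAcc_subst e, Iso.inv_subst ω]
end

theorem Iso.Step.inv {ω ω' : Iso} (h : Iso.Step ω ω') : Iso.Step ω.inv ω'.inv := by
  induction h with
  | fix ω => rw [Iso.inv_subst]; exact .fix _
  | beta ω₁ ω₂ => rw [Iso.inv_subst]; exact .beta _ _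
  | app ω₂ _ ih => exact .app _ ih

/-- The environment `E` is reused unchanged; `WellScoped` was required in both directions, and its
two halves trade places. -/
theorem Big.inv {ω : Iso} {a b : Val} (h : Big ω a b) : Big ω.inv b a := by
  induction h with
  | step h _ ih => exact .step h.inv ih
  | @abs cs v e E hE hm hs _ ih =>
    have hr : (e.invAcc (.val v)).result = v := Expr.result_invAcc e _
    have hp : (e.invAcc (.val v)).letPats = (e.letPats.map Prod.swap).reverse := by
      simp [Expr.letPats, Expr.lets_invAcc, Expr.lets, Function.comp_def]
    have := Big.abs (cs := cs.inv) (v := e.result) (e := e.invAcc (.val v)) E hE hm.inv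
      ⟨hs.right_nodup, by rw [hp, hr]; exact hs.backward, by rw [hr]; exact hs.left_nodup, by
        rw [hp, hr]
        simpa [Function.comp_def] using hs.forward⟩ (by
        rw [Expr.lets_invAcc]
        intro t ht
        simp only [Expr.lets, List.append_nil, List.mem_reverse, List.mem_map] at ht
        obtain ⟨t, ht, rfl⟩ := ht
        exact ih t ht)
    rwa [hr] at this

/-! #### Soundness for the reduction relation -/

open Classical in
/-- The restriction of a total environment to a list of variables. -/
noncomputable def restrict (E : ℕ → Val) (S : List ℕ) : Valuation :=
  fun x => if x ∈ S then some (E x) else none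

/-- Minimality of the matching valuation forces its support to be exactly `v.vars`; linearity gives
the disjoint supports at a pair. -/
theorem Val.match_bind (E : ℕ → Val) (v : Val) (h : v.vars.Nodup) :
    Match (restrict E v.vars) v (v.bind E) := by
  induction v with
  | unit =>
    have : restrict E Val.unit.vars = fun _ => none := by ext; simp [restrict, Val.vars]
    rw [this]; exact .unit
  | var x =>
    have : restrict E (Val.var x).vars = fun y => if y = x then some (E x) else none := by
      funext y
      by_cases hy : y = x <;> simp [restrict, Val.vars, hy]
    rw [this]; exact .var _ _
  | inl v ih => exact .inl (ih h)
  | inr v ih => exact .inr (ih h)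
  | fold v ih => exact .fold (ih h)
  | pair v w ihv ihw =>
    rw [Val.vars, List.nodup_append'] at h
    have : restrict E (Val.pair v w).vars =
        fun x => (restrict E v.vars x).or (restrict E w.vars x) := by
      funext x
      by_cases hv : x ∈ v.vars <;> by_cases hw : x ∈ w.vars <;>
        simp [restrict, Val.vars, hv, hw]
    rw [this]
    refine .pair (ihv h.1) (ihw h.2.1) fun x => ?_
    by_cases hv : x ∈ v.vars
    · right; simpa [restrict] using h.2.2 hv
    · left; simpa [restrict] using hv

theorem Val.subst_restrict (E : ℕ → Val) {S : List ℕ} {v : Val} (h : v.vars ⊆ S) :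
    v.toTerm.subst (restrict E S) = (v.bind E).toTerm := by
  induction v with
  | unit => rfl
  | var x =>
    have : x ∈ S := h (by simp [Val.vars])
    simp [Val.toTerm, Term.subst, restrict, this, Val.bind]
  | inl v ih => simpa [Val.toTerm, Term.subst, Val.bind] using ih h
  | inr v ih => simpa [Val.toTerm, Term.subst, Val.bind] using ih h
  | fold v ih => simpa [Val.toTerm, Term.subst, Val.bind] using ih h
  | pair v w ihv ihw =>
    rw [Val.vars, List.append_subset] at h
    simp [Val.toTerm, Term.subst, Val.bind, ihv h.1, ihw h.2]

/-- Values already inserted by `σ` are closed, so `τ` cannot act on them, and `σ` takes precedence.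
-/
theorem Term.subst_subst (t : Term) (σ τ : Valuation) (hσ : ∀ x v, σ x = some v → v.Closed) :
    (t.subst σ).subst τ = t.subst fun x => (σ x).or (τ x) := by
  induction t generalizing σ τ with
  | unit => rfl
  | var x =>
    cases h : σ x with
    | none => simp [Term.subst, h]
    | some v => simp [Term.subst, h, (hσ x v h).subst_toTerm]
  | inl t ih => simp [Term.subst, ih σ τ hσ]
  | inr t ih => simp [Term.subst, ih σ τ hσ]
  | fold t ih => simp [Term.subst, ih σ τ hσ]
  | app ω t ih => simp [Term.subst, ih σ τ hσ]
  | pair t u iht ihu => simp [Term.subst, iht σ τ hσ, ihu σ τ hσ]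
  | letIn p t u iht ihu =>
    simp only [Term.subst, iht σ τ hσ, Term.letIn.injEq, true_and]
    rw [ihu]
    · congr 1
      funext x
      split <;> rfl
    · intro x v hx
      split at hx
      · simp at hx
      · exact hσ x v hx

theorem Term.Reduces.letArg (p : Pat) {t t' : Term} (u : Term) (h : t.Reduces t') :
    (Term.letIn p t u).Reduces (.letIn p t' u) :=
  Relation.ReflTransGen.lift (p := Term.Step) (fun t => Term.letIn p t u)
    (fun _ _ h => Term.Step.letArg p u h) t t' h

/-- Throughout the evaluation the accumulated substitution is `E` restricted to the variables in
scope; each `let` enlarges the scope by its left pattern. -/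
theorem Expr.reduces (E : ℕ → Val) (hE : ∀ x, (E x).Closed) (e : Expr) (S : List ℕ)
    (hs : InScope S e.letPats e.result.vars)
    (h : ∀ t ∈ e.lets, Term.Reduces (.app t.2.1 (t.2.2.toVal.bind E).toTerm)
      (t.1.toVal.bind E).toTerm) :
    (e.toTerm.subst (restrict E S)).Reduces (e.result.bind E).toTerm := by
  match e with
  | .val v =>
    rw [Expr.toTerm, Val.subst_restrict (v := v) E hs]
    exact .refl
  | .letIn p₁ ω p₂ e =>
    obtain ⟨h₂, h₁, hs⟩ := hs
    have h0 := h (p₁, ω, p₂) (by simp [Expr.lets])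
    have ih := Expr.reduces E hE e (p₁.vars ++ S) hs fun t ht => h t (by simp [Expr.lets, ht])
    rw [Expr.toTerm, Term.subst, Term.subst,
      Val.subst_restrict E (by rw [Pat.vars_toVal]; exact h₂)]
    refine (Term.Reduces.letArg p₁ _ h0).trans (.head (.letVal _ (Val.match_bind E _ ?_)) ?_)
    · rw [Pat.vars_toVal]; exact h₁
    -- The outer substitution omits the variables of `p₁` and the match supplies them. Both are
    -- restrictions of `E`, so together they restrict it to `p₁.vars ++ S`.
    · rw [Term.subst_subst]
      · refine Eq.subst (motive := fun σ => Term.Reduces (e.toTerm.subst σ) _) ?_ ih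
        funext x
        by_cases hp : x ∈ p₁.vars <;> by_cases hx : x ∈ S <;>
          simp [restrict, hp, hx, Pat.vars_toVal]
      · intro x v hx
        simp only [restrict] at hx
        split_ifs at hx
        cases hx
        exact hE x

theorem Big.reduces {ω : Iso} {a b : Val} (h : Big ω a b) :
    Term.Reduces (.app ω a.toTerm) b.toTerm := by
  induction h with
  | step h _ ih => exact .head (.iso _ h) ih
  | abs E hE hm hs _ ih =>
    exact .head (.clause hm (Val.match_bind E _ hs.left_nodup))
      (Expr.reduces E hE _ _ hs.forward ih)

/-! #### Isos without free variables -/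

mutual
/-- All free iso variables are below `n`. -/
def Iso.ClosedAt : Iso → ℕ → Prop
  | .abs cs, n => cs.ClosedAt n
  | .fix ω, n => ω.ClosedAt (n + 1)
  | .lam ω, n => ω.ClosedAt (n + 1)
  | .var i, n => i < n
  | .app ω₁ ω₂, n => ω₁.ClosedAt n ∧ ω₂.ClosedAt n
/-- All free iso variables are below `n`. -/
def Clauses.ClosedAt : Clauses → ℕ → Prop
  | .nil, _ => True
  | .cons _ e cs, n => e.ClosedAt n ∧ cs.ClosedAt n
/-- All free iso variables are below `n`. -/
def Expr.ClosedAt : Expr → ℕ → Prop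
  | .val _, _ => True
  | .letIn _ ω _ e, n => ω.ClosedAt n ∧ e.ClosedAt n
end

mutual
theorem Iso.ClosedAt.mono {ω : Iso} {n k : ℕ} (h : ω.ClosedAt n) (hk : n ≤ k) : ω.ClosedAt k := by
  match ω with
  | .abs cs => exact Clauses.ClosedAt.mono (cs := cs) h hk
  | .fix ω => exact Iso.ClosedAt.mono (ω := ω) h (by omega)
  | .lam ω => exact Iso.ClosedAt.mono (ω := ω) h (by omega)
  | .var i => exact lt_of_lt_of_le h hk
  | .app ω₁ ω₂ => exact ⟨Iso.ClosedAt.mono (ω := ω₁) h.1 hk, Iso.ClosedAt.mono (ω := ω₂) h.2 hk⟩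
theorem Clauses.ClosedAt.mono {cs : Clauses} {n k : ℕ} (h : cs.ClosedAt n) (hk : n ≤ k) :
    cs.ClosedAt k := by
  match cs with
  | .nil => trivial
  | .cons v e cs =>
    exact ⟨Expr.ClosedAt.mono (e := e) h.1 hk, Clauses.ClosedAt.mono (cs := cs) h.2 hk⟩
theorem Expr.ClosedAt.mono {e : Expr} {n k : ℕ} (h : e.ClosedAt n) (hk : n ≤ k) :
    e.ClosedAt k := by
  match e with
  | .val v => trivial
  | .letIn p₁ ω p₂ e =>
    exact ⟨Iso.ClosedAt.mono (ω := ω) h.1 hk, Expr.ClosedAt.mono (e := e) h.2 hk⟩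
end

mutual
theorem Iso.ClosedAt.lift {ω : Iso} {k : ℕ} (h : ω.ClosedAt k) : ω.lift k = ω := by
  match ω with
  | .abs cs => simp [Iso.lift, Clauses.ClosedAt.lift (cs := cs) h]
  | .fix ω => simp [Iso.lift, Iso.ClosedAt.lift (ω := ω) h]
  | .lam ω => simp [Iso.lift, Iso.ClosedAt.lift (ω := ω) h]
  | .var i => exact if_pos h
  | .app ω₁ ω₂ =>
    simp [Iso.lift, Iso.ClosedAt.lift (ω := ω₁) h.1, Iso.ClosedAt.lift (ω := ω₂) h.2]
theorem Clauses.ClosedAt.lift {cs : Clauses} {k : ℕ} (h : cs.ClosedAt k) : cs.lift k = cs := by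
  match cs with
  | .nil => rfl
  | .cons v e cs =>
    simp [Clauses.lift, Expr.ClosedAt.lift (e := e) h.1, Clauses.ClosedAt.lift (cs := cs) h.2]
theorem Expr.ClosedAt.lift {e : Expr} {k : ℕ} (h : e.ClosedAt k) : e.lift k = e := by
  match e with
  | .val v => rfl
  | .letIn p₁ ω p₂ e =>
    simp [Expr.lift, Iso.ClosedAt.lift (ω := ω) h.1, Expr.ClosedAt.lift (e := e) h.2]
end

mutual
theorem Iso.ClosedAt.subst {ω : Iso} {k : ℕ} (h : ω.ClosedAt k) (ω' : Iso) :
    ω.subst k ω' = ω := by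
  match ω with
  | .abs cs => simp [Iso.subst, Clauses.ClosedAt.subst (cs := cs) h]
  | .fix ω => simp [Iso.subst, Iso.ClosedAt.subst (ω := ω) h]
  | .lam ω => simp [Iso.subst, Iso.ClosedAt.subst (ω := ω) h]
  | .var i => exact if_pos h
  | .app ω₁ ω₂ =>
    simp [Iso.subst, Iso.ClosedAt.subst (ω := ω₁) h.1, Iso.ClosedAt.subst (ω := ω₂) h.2]
theorem Clauses.ClosedAt.subst {cs : Clauses} {k : ℕ} (h : cs.ClosedAt k) (ω' : Iso) :
    cs.subst k ω' = cs := by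
  match cs with
  | .nil => rfl
  | .cons v e cs =>
    simp [Clauses.subst, Expr.ClosedAt.subst (e := e) h.1, Clauses.ClosedAt.subst (cs := cs) h.2]
theorem Expr.ClosedAt.subst {e : Expr} {k : ℕ} (h : e.ClosedAt k) (ω' : Iso) :
    e.subst k ω' = e := by
  match e with
  | .val v => rfl
  | .letIn p₁ ω p₂ e =>
    simp [Expr.subst, Iso.ClosedAt.subst (ω := ω) h.1, Expr.ClosedAt.subst (e := e) h.2]
end

/-- Isos such as `dup A` occur inside the body of a `fix`; this shows that unfolding leaves them
alone. -/
theorem Iso.ClosedAt.subst_eq {ω : Iso} (h : ω.ClosedAt 0) (k : ℕ) (ω' : Iso) :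
    ω.subst k ω' = ω :=
  (h.mono (Nat.zero_le k)).subst ω'

theorem Clauses.closedAt_ofList {cs : List (Val × Expr)} {n : ℕ}
    (h : ∀ c ∈ cs, c.2.ClosedAt n) : (Clauses.ofList cs).ClosedAt n := by
  induction cs with
  | nil => trivial
  | cons c cs ih => exact ⟨h c (by simp), ih fun c hc => h c (by simp [hc])⟩

/-! #### Evaluation of a clause in a finite environment -/

theorem Clauses.mem_ofList {cs : List (Val × Expr)} {v : Val} {e : Expr} (h : (v, e) ∈ cs) :
    (Clauses.ofList cs).Mem v e := by
  induction cs with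
  | nil => simp at h
  | cons c cs ih =>
    rcases List.mem_cons.1 h with rfl | h
    · exact .head _
    · exact .tail _ _ (ih h)

theorem Clauses.Mem.subst {cs : Clauses} {v : Val} {e : Expr} (h : cs.Mem v e) (k : ℕ)
    (ω : Iso) : (cs.subst k ω).Mem v (e.subst k ω) := by
  induction h with
  | head cs => exact .head _
  | tail v' e' _ ih => exact .tail _ _ ih

/-- Iso substitution never touches patterns, so scoping can be checked before a `fix` is unfolded.
-/
theorem Expr.letPats_subst (e : Expr) (k : ℕ) (ω : Iso) :
    (e.subst k ω).letPats = e.letPats := by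
  match e with
  | .val v => rfl
  | .letIn p₁ _ p₂ e => exact congrArg (List.cons (p₁, p₂)) (Expr.letPats_subst e k ω)

theorem WellScoped.subst {v : Val} {e : Expr} (h : WellScoped v e) (k : ℕ) (ω : Iso) :
    WellScoped v (e.subst k ω) := by
  obtain ⟨h₁, h₂, h₃, h₄⟩ := h
  constructor <;> simpa only [Expr.letPats_subst, Expr.result_subst]

/-- The environment that maps the variable `i` to the entry `i` of a list. -/
def env (l : List Val) (x : ℕ) : Val := l.getD x .unit

/-- Beyond the end of the list the default `.unit` is closed as well, so only the listed entries
have to be checked. -/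
theorem env_closed {l : List Val} (h : ∀ v ∈ l, v.Closed) (x : ℕ) : (env l x).Closed := by
  unfold env
  rw [List.getD_eq_getElem?_getD]
  cases hx : l[x]? with
  | none => simp
  | some v => exact h v (List.mem_of_getElem? hx)

/-- All `let`s of an expression are valid in an environment. -/
def Expr.Runs (E : ℕ → Val) : Expr → Prop
  | .val _ => True
  | .letIn p₁ ω p₂ e => Big ω (p₂.toVal.bind E) (p₁.toVal.bind E) ∧ e.Runs E

/-- `Runs` is a nested conjunction, so that concrete evaluations can list one proof per `let` in an
anonymous constructor. -/
theorem Expr.Runs.lets {E : ℕ → Val} {e : Expr} (h : e.Runs E) :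
    ∀ t ∈ e.lets, Big t.2.1 (t.2.2.toVal.bind E) (t.1.toVal.bind E) := by
  match e with
  | .val v => simp [Expr.lets]
  | .letIn p₁ ω p₂ e =>
    intro t ht
    rcases List.mem_cons.1 ht with rfl | ht
    · exact h.1
    · exact Expr.Runs.lets h.2 t ht

/-- The input and output are given by equations, which for a concrete clause and environment usually
hold by `rfl`. -/
theorem Big.clause {cs : Clauses} {v : Val} {e : Expr} {a b : Val} (l : List Val)
    (hl : ∀ v ∈ l, v.Closed) (hm : cs.Mem v e) (hs : WellScoped v e)
    (ha : v.bind (env l) = a) (hb : e.result.bind (env l) = b) (h : e.Runs (env l)) :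
    Big (.abs cs) a b := by
  subst ha hb
  exact .abs (env l) (env_closed hl) hm hs h.lets

theorem Big.fix_clause {cs : Clauses} {v : Val} {e : Expr} {a b : Val} (l : List Val)
    (hl : ∀ v ∈ l, v.Closed) (hm : cs.Mem v e) (hs : WellScoped v e)
    (ha : v.bind (env l) = a) (hb : e.result.bind (env l) = b)
    (h : (e.subst 0 (.fix (.abs cs))).Runs (env l)) :
    Big (.fix (.abs cs)) a b := by
  subst ha hb
  refine .step (.fix _) ?_
  have := Big.abs (env l) (env_closed hl) (hm.subst 0 (.fix (.abs cs))) (hs.subst 0 _) h.lets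
  rwa [Expr.result_subst] at this

theorem Big.subst_closed {ω : Iso} {a b : Val} (h : Big ω a b) (hω : ω.ClosedAt 0) (k : ℕ)
    (ω' : Iso) : Big (ω.subst k ω') a b := by
  rwa [hω.subst_eq]

end RevLang

/-! ### Evaluation of the auxiliary isos -/

namespace RevLang

attribute [local simp] InScope Val.vars Pat.vars Expr.letPats Expr.lets Expr.result Expr.subst

/-- Turns scoping of a concrete clause into a conjunction about explicit lists of numbers, which
`simp` decides. -/
theorem wellScoped_iff {v : Val} {e : Expr} : WellScoped v e ↔
    v.vars.Nodup ∧ InScope v.vars e.letPats e.result.vars ∧ e.result.vars.Nodup ∧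
      InScope e.result.vars (e.letPats.map Prod.swap).reverse v.vars :=
  ⟨fun ⟨h₁, h₂, h₃, h₄⟩ => ⟨h₁, h₂, h₃, h₄⟩, fun ⟨h₁, h₂, h₃, h₄⟩ => ⟨h₁, h₂, h₃, h₄⟩⟩

-- Numerals and closedness of encoded data.

/-- The numeral `k` of type `nat`. -/
def Val.ofNat : ℕ → Val
  | 0 => .zero
  | k + 1 => .succ (.ofNat k)

@[simp] theorem Val.closed_ofNat (k : ℕ) : (Val.ofNat k).Closed := by
  induction k with
  | zero => rfl
  | succ k ih => exact ih

@[simp] theorem Val.vars_nil : Val.nil.vars = [] := rfl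

@[simp] theorem Val.vars_zero : Val.zero.vars = [] := rfl

@[simp] theorem Val.vars_tt : Val.tt.vars = [] := rfl

@[simp] theorem Val.vars_ff : Val.ff.vars = [] := rfl

@[simp] theorem Val.vars_succ (v : Val) : v.succ.vars = v.vars := rfl

@[simp] theorem Val.vars_cons (v w : Val) : (v.cons w).vars = v.vars ++ w.vars := rfl

@[simp] theorem Val.closed_nil : Val.nil.Closed := rfl

@[simp] theorem Val.closed_zero : Val.zero.Closed := rfl

@[simp] theorem Val.closed_tt : Val.tt.Closed := rfl

@[simp] theorem Val.closed_ff : Val.ff.Closed := rfl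

@[simp] theorem Val.closed_cons {v w : Val} : (v.cons w).Closed ↔ v.Closed ∧ w.Closed :=
  Val.closed_pair

@[simp] theorem Val.closed_succ {v : Val} : v.succ.Closed ↔ v.Closed := Iff.rfl

@[simp] theorem Val.closed_ofList {l : List Val} :
    (Val.ofList l).Closed ↔ ∀ v ∈ l, v.Closed := by
  induction l with
  | nil => simp [Val.ofList]
  | cons v l ih => simp [Val.ofList, ih]

@[simp] theorem Val.closed_finInj (n i : ℕ) : (Val.finInj n i).Closed := by
  fun_induction Val.finInj n i with
  | case4 n i ih => exact ih
  | _ => rfl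

/-! #### Duplication -/

theorem dup_finSum_closedAt (n : ℕ) : (dup (.finSum n)).ClosedAt 0 := by
  fun_induction Ty.finSum n with
  | case3 n ih => exact ⟨⟨⟨trivial, trivial⟩, trivial⟩, ⟨ih, trivial⟩, trivial⟩
  | _ => exact ⟨trivial, trivial⟩

theorem big_dup_one : Big (dup .one) .unit (.pair .unit .unit) :=
  .clause [] (by simp) (.head _) (by simp [wellScoped_iff]) rfl rfl trivial

theorem big_dup_finSum {n i : ℕ} (hi : i < n) :
    Big (dup (.finSum n)) (.finInj n i) (.pair (.finInj n i) (.finInj n i)) := by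
  fun_induction Val.finInj n i with
  | case1 => omega
  | case2 => exact big_dup_one
  | case3 n =>
    exact .clause [.unit, .unit, .unit] (by simp) (.head _) (by simp [wellScoped_iff]) rfl rfl
      ⟨big_dup_one, trivial⟩
  | case4 n i ih =>
    exact .clause [.finInj (n + 1) i, .finInj (n + 1) i, .finInj (n + 1) i] (by simp)
      (.tail _ _ (.head _)) (by simp [wellScoped_iff]) rfl rfl ⟨ih (by omega), trivial⟩

theorem big_dup_tensor {A B : Ty} {v w : Val} (hv : v.Closed) (hw : w.Closed)
    (hA : Big (dup A) v (.pair v v)) (hB : Big (dup B) w (.pair w w)) :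
    Big (dup (.tensor A B)) (.pair v w) (.pair (.pair v w) (.pair v w)) :=
  .clause [v, w, v, v, w, w] (by simp [hv, hw]) (.head _) (by simp [wellScoped_iff]) rfl rfl
    ⟨hA, hB, trivial⟩

theorem big_dup_list {A : Ty} (hA : (dup A).ClosedAt 0) {l : List Val}
    (hl : ∀ v ∈ l, v.Closed ∧ Big (dup A) v (.pair v v)) :
    Big (dup (.list A)) (.ofList l) (.pair (.ofList l) (.ofList l)) := by
  induction l with
  | nil =>
    exact .fix_clause [.inl .unit, .inl .unit, .inl .unit] (by simp) (.head _)
      (by simp [wellScoped_iff]) rfl rfl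
      ⟨.clause [.unit, .unit, .unit] (by simp) (.head _) (by simp [wellScoped_iff]) rfl rfl
        ⟨big_dup_one, trivial⟩, trivial⟩
  | cons v l ih =>
    have ih := ih fun w hw => hl w (by simp [hw])
    obtain ⟨hv, hd⟩ := hl v (by simp)
    have hc : (Val.ofList l).Closed :=
      Val.closed_ofList.2 fun w hw => (hl w (by simp [hw])).1
    -- The nested clauses follow the type `μ X. I ⊕ (A ⊗ X)`: fold, right injection, pair, and
    -- finally the type variable.
    refine .fix_clause [.inr (.pair v (.ofList l)), .inr (.pair v (.ofList l)),
      .inr (.pair v (.ofList l))] (by simp [hv, hc]) (.head _) (by simp [wellScoped_iff])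
      rfl rfl ⟨?_, trivial⟩
    refine .clause [.pair v (.ofList l), .pair v (.ofList l), .pair v (.ofList l)]
      (by simp [hv, hc]) (.tail _ _ (.head _)) (by simp [wellScoped_iff]) rfl rfl ⟨?_, trivial⟩
    refine .clause [v, .ofList l, v, v, .ofList l, .ofList l]
      (by simp [hv, hc]) (.head _) (by simp [wellScoped_iff]) rfl rfl
      ⟨hd.subst_closed hA _ _, ?_, trivial⟩
    -- At the type variable, unfolding has inserted the duplication of the whole list type, so `ih`
    -- applies.
    exact .clause [.ofList l, .ofList l, .ofList l]
      (by simp [hc]) (.head _) (by simp [wellScoped_iff]) rfl rfl ⟨ih, trivial⟩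

/-! #### Lists -/

theorem big_erase {v x : Val} (hv : v.Closed) (hx : x.Closed) : Big (erase v) (.pair x v) x :=
  .clause [x] (by simp [hx]) (.head _) (by simp [wellScoped_iff, show v.vars = [] from hv])
    (congrArg (Val.pair x) (hv.bind _)) rfl trivial

theorem big_succIso {x : Val} (hx : x.Closed) : Big succIso x x.succ :=
  .clause [x] (by simp [hx]) (.head _) (by simp [wellScoped_iff]) rfl rfl trivial

theorem big_consIso {h t : Val} (hh : h.Closed) (ht : t.Closed) :
    Big consIso (.pair h t) (.cons h t) :=
  .clause [h, t] (by simp [hh, ht]) (.head _) (by simp [wellScoped_iff]) rfl rfl trivial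

theorem big_len {l : List Val} (hl : ∀ v ∈ l, v.Closed) :
    Big len (.ofList l) (.pair (.ofList l) (.ofNat l.length)) := by
  induction l with
  | nil => exact .fix_clause [] (by simp) (.head _) (by simp [wellScoped_iff]) rfl rfl trivial
  | cons v l ih =>
    rw [List.forall_mem_cons] at hl
    exact .fix_clause [v, .ofList l, .ofList l, .ofNat l.length] (by simpa using hl)
      (.tail _ _ (.head _)) (by simp [wellScoped_iff]) rfl rfl ⟨ih hl.2, trivial⟩

/-- The counter is the length of the remaining list, so it reaches zero exactly when the list is
exhausted. -/
theorem big_snoc' {A : Ty} (hA : (dup A).ClosedAt 0) {l : List Val} {x : Val}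
    (hl : ∀ v ∈ l, v.Closed) (hx : x.Closed) (hd : Big (dup A) x (.pair x x)) :
    Big (snoc' A) (.pair (.ofList l) (.pair x (.ofNat l.length)))
      (.pair (.ofList (l ++ [x])) (.pair x (.ofNat l.length))) := by
  induction l with
  | nil =>
    exact .fix_clause [x, x, x] (by simp [hx]) (.head _) (by simp [wellScoped_iff]) rfl rfl
      ⟨hd.subst_closed hA _ _, trivial⟩
  | cons v l ih =>
    rw [List.forall_mem_cons] at hl
    exact .fix_clause [v, .ofList l, x, .ofNat l.length, .ofList (l ++ [x]), x, .ofNat l.length]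
      (by simpa [hx, or_imp, forall_and] using hl)
      (.tail _ _ (.head _)) (by simp [wellScoped_iff]) rfl rfl ⟨ih hl.2, trivial⟩

theorem big_snoc {A : Ty} (hA : (dup A).ClosedAt 0) {l : List Val} {x : Val}
    (hl : ∀ v ∈ l, v.Closed) (hx : x.Closed) (hd : Big (dup A) x (.pair x x)) :
    Big (snoc A) (.pair (.ofList l) x) (.pair (.ofList (l ++ [x])) x) := by
  have hlx : ∀ v ∈ l ++ [x], v.Closed := by simpa [hx, or_imp, forall_and] using hl
  -- The counter is removed by running `len` backwards on the longer list; this is why it must first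
  -- be increased by one.
  have hlen := (big_len hlx).inv
  rw [List.length_append] at hlen
  exact .clause [.ofList l, x, .ofList l, .ofNat l.length, .ofList (l ++ [x]), x,
      .ofNat l.length, .succ (.ofNat l.length), .ofList (l ++ [x])]
    (by simpa [hx, or_imp, forall_and] using hl) (.head _) (by simp [wellScoped_iff]) rfl rfl
    ⟨big_len hl, big_snoc' hA hl hx hd, big_succIso (Val.closed_ofNat _), hlen, trivial⟩

theorem big_growth {A : Ty} (hA : (dup A).ClosedAt 0) {l r : List Val} {b : Val}
    (hl : ∀ v ∈ l, v.Closed) (hr : ∀ v ∈ r, v.Closed) (hb : b.Closed)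
    (hd : Big (dup A) b (.pair b b)) :
    Big (growth A b) (.pair (.ofList l) (.ofList r))
      (.pair (.ofList (l ++ [b])) (.ofList (r ++ [b]))) := by
  have hlb : (Val.ofList (l ++ [b])).Closed := by simpa [hb, or_imp, forall_and] using hl
  have hrb : (Val.ofList (r ++ [b])).Closed := by simpa [hb, or_imp, forall_and] using hr
  have hl' := Val.closed_ofList.2 hl
  have hr' := Val.closed_ofList.2 hr
  exact .clause [.ofList l, .ofList r, .pair (.ofList l) b, .ofList (l ++ [b]), b,
      .pair (.ofList r) b, .ofList (r ++ [b]), b, .ofList (l ++ [b]), .ofList (r ++ [b])]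
    (by simp only [List.forall_mem_cons, Val.closed_pair]; simp [hl', hr', hlb, hrb, hb, -Val.closed_ofList])
    (.head _) (by simp [wellScoped_iff]) rfl rfl
    ⟨(big_erase hb hl').inv, big_snoc hA hl hb hd, (big_erase hb hr').inv,
      big_snoc hA hr hb hd, big_erase hb hlb, big_erase hb hrb, trivial⟩

theorem growth_closedAt {A : Ty} (hA : (dup A).ClosedAt 0) (b : Val) :
    (growth A b).ClosedAt 0 := by
  have hA' := hA.mono (Nat.zero_le 1)
  simp [growth, snoc, snoc', len, succIso, erase, Iso.mk, Clauses.ofList, Iso.inv, Clauses.inv,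
    Expr.invAcc, Iso.ClosedAt, Clauses.ClosedAt, Expr.ClosedAt, hA']

/-- The recursion strips `k` copies of `b` and stops at the empty list or at a head that has its own
clause, whence the condition on `l.head?`. -/
theorem big_rmBlank {b : Val} {as l : List Val} (hb : b.Closed) (hl : ∀ v ∈ l, v.Closed)
    (has : ∀ a ∈ l.head?, a ∈ as) (k : ℕ) :
    Big (rmBlank b as) (.ofList (List.replicate k b ++ l)) (.pair (.ofList l) (.ofNat k)) := by
  induction k with
  | zero =>
    cases l with
    | nil => exact .fix_clause [] (by simp) (.head _) (by simp [wellScoped_iff]) rfl rfl trivial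
    | cons a l =>
      rw [List.forall_mem_cons] at hl
      have ha : a.vars = [] := hl.1
      refine .fix_clause (v := .cons a (.var 0)) (e := .val (.pair (.cons a (.var 0)) .zero))
        [.ofList l] (by simpa using hl.2)
        (.tail _ _ (.tail _ _ (Clauses.mem_ofList (List.mem_map.2 ⟨a, has a (by simp), rfl⟩))))
        (by simp [wellScoped_iff, ha]) ?_ ?_ trivial
      · simp [Val.bind, Val.cons, hl.1.bind, env, Val.ofList]
      · simp [Val.bind, Val.cons, hl.1.bind, env, Val.ofList, Expr.result, Val.zero, Val.ofNat]
  | succ k ih =>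
    have hv : b.vars = [] := hb
    refine .fix_clause [.ofList (List.replicate k b ++ l), .ofList l, .ofNat k] ?_
      (.tail _ _ (.head _)) (by simp [wellScoped_iff, hv]) ?_ rfl ⟨ih, trivial⟩
    · have : ∀ v ∈ List.replicate k b ++ l, v.Closed := by
        intro v hv
        rcases List.mem_append.1 hv with hv | hv
        · rwa [List.eq_of_mem_replicate hv]
        · exact hl v hv
      simp only [List.forall_mem_cons, Val.closed_ofList]
      simpa using ⟨by simpa using this, hl⟩
    · simp [Val.bind, Val.cons, hb.bind, env, Val.ofList, List.replicate_succ]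

theorem big_revAux {A : Ty} (hA : (dup A).ClosedAt 0) {l r : List Val}
    (hl : ∀ v ∈ l, v.Closed ∧ Big (dup A) v (.pair v v)) (hr : ∀ v ∈ r, v.Closed) :
    Big (revAux A) (.pair (.ofList l) (.ofList r))
      (.pair (.ofList l) (.ofList (l.reverse ++ r))) := by
  induction l generalizing r with
  | nil =>
    exact .fix_clause [.ofList r] (by simpa using hr) (.head _) (by simp [wellScoped_iff])
      rfl rfl trivial
  | cons v l ih =>
    rw [List.forall_mem_cons] at hl
    obtain ⟨⟨hv, hd⟩, hl⟩ := hl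
    -- The recursive call has `v` pushed onto the accumulator.
    have ih := ih (r := v :: r) hl (by simpa [hv] using hr)
    have hlc : (Val.ofList l).Closed := Val.closed_ofList.2 fun v h => (hl v h).1
    have hrc : (Val.ofList r).Closed := Val.closed_ofList.2 hr
    have hc : (Val.ofList (l.reverse ++ v :: r)).Closed := by
      rw [Val.closed_ofList] at *
      intro w hw
      simp only [List.mem_append, List.mem_reverse, List.mem_cons] at hw
      rcases hw with hw | rfl | hw
      exacts [hlc w hw, hv, hr w hw]
    rw [List.reverse_cons, List.append_assoc, List.singleton_append]
    exact .fix_clause [v, .ofList l, .ofList r, v, v, .cons v (.ofList r), .ofList l,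
        .ofList (l.reverse ++ v :: r)]
      (by simp only [List.forall_mem_cons, Val.closed_cons]; simp [hv, hlc, hrc, hc, -Val.closed_ofList])
      (.tail _ _ (.head _)) (by simp [wellScoped_iff]) rfl rfl
      ⟨hd.subst_closed hA _ _, big_consIso hv hrc, ih, trivial⟩

theorem big_rev {A : Ty} (hA : (dup A).ClosedAt 0) {l : List Val}
    (hl : ∀ v ∈ l, v.Closed ∧ Big (dup A) v (.pair v v)) :
    Big (rev A) (.ofList l) (.pair (.ofList l) (.ofList l.reverse)) := by
  have hc : ∀ v ∈ l, v.Closed := fun v h => (hl v h).1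
  have h := big_revAux hA hl (r := []) (by simp)
  rw [List.append_nil] at h
  exact .clause [.ofList l, .pair (.ofList l) .nil, .ofList l, .ofList l.reverse]
    (by simpa using hc) (.head _) (by simp [wellScoped_iff]) rfl rfl
    ⟨(big_erase Val.closed_nil (Val.closed_ofList.2 hc)).inv, h, trivial⟩

theorem big_cleanUp {A : Ty} (hA : (dup A).ClosedAt 0) {b q s c : Val} {as w : List Val}
    (hb : b.Closed) (hd : Big (dup A) b (.pair b b)) (hq : q.Closed) (hs : s.Closed)
    (hc : c.Closed) (hw : ∀ v ∈ w, v.Closed ∧ Big (dup A) v (.pair v v) ∧ v ∈ as) (j k : ℕ) :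
    Big (cleanUp A b as)
      (.pair (.pair q (.pair (.ofList (.replicate j b))
        (.pair s (.ofList (w ++ List.replicate k b))))) c)
      (.pair (.pair q (.pair .nil (.pair s (.ofList w))))
        (.pair c (.pair (.ofNat j) (.pair (.ofNat k) (.ofList (w ++ List.replicate k b)))))) := by
  have hblank : ∀ i, ∀ v ∈ List.replicate i b, v.Closed := fun i v hv => by
    rwa [List.eq_of_mem_replicate hv]
  have hwc : ∀ v ∈ w, v.Closed := fun v hv => (hw v hv).1
  have hwr : ∀ v ∈ w.reverse, v.Closed := by simpa using hwc
  have hr : ∀ v ∈ w ++ List.replicate k b, v.Closed ∧ Big (dup A) v (.pair v v) := by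
    intro v hv
    rcases List.mem_append.1 hv with hv | hv
    · exact ⟨(hw v hv).1, (hw v hv).2.1⟩
    · rw [List.eq_of_mem_replicate hv]
      exact ⟨hb, hd⟩
  have h₁ := big_rmBlank (as := as) hb (l := []) (by simp) (by simp) j
  rw [List.append_nil] at h₁
  have h₂ := big_rev hA hr
  rw [List.reverse_append, List.reverse_replicate] at h₂
  have h₃ := big_rmBlank (as := as) hb hwr (fun a ha =>
    (hw a (List.mem_reverse.1 (List.mem_of_mem_head? ha))).2.2) k
  have h₄ := big_rev hA (l := w.reverse) fun v hv =>
    have := hw v (List.mem_reverse.1 hv); ⟨this.1, this.2.1⟩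
  -- `h₄` produces the pair of `w.reverse` and `w`. With its components swapped, this is the output
  -- of `rev` on `w`, so the inverse leaves `w` alone and no extra copy.
  have h₅ := (big_rev hA (l := w) fun v hv => ⟨(hw v hv).1, (hw v hv).2.1⟩).inv
  rw [List.reverse_reverse] at h₄
  refine .clause [q, .ofList (.replicate j b), s, .ofList (w ++ List.replicate k b), c,
      .nil, .ofNat j, .ofList (w ++ List.replicate k b), .ofList (List.replicate k b ++ w.reverse),
      .ofList w.reverse, .ofNat k, .ofList w.reverse, .ofList w, .ofList w] ?_
    (.head _) (by simp [wellScoped_iff]) rfl rfl ⟨h₁, h₂, h₃, h₄, h₅, trivial⟩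
  have h₆ : ∀ v ∈ w ++ List.replicate k b, v.Closed := fun v hv => (hr v hv).1
  have h₇ : ∀ v ∈ List.replicate k b ++ w.reverse, v.Closed := fun v hv => by
    rcases List.mem_append.1 hv with hv | hv
    exacts [hblank k v hv, hwr v hv]
  simp only [List.forall_mem_cons, Val.closed_ofList]
  exact ⟨hq, hblank j, hs, h₆, hc, rfl, by simp, h₆, h₇, hwr, by simp, hwr, hwc, hwc, by simp⟩

/-! #### Iteration and garbage removal -/

/-- The iso to which `iter` applied to a closed iso reduces. -/
def iterFix (ω : Iso) : Iso := .fix <| .mk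
  [(.var 0,
    .letIn (.var 1) ω (.var 0) <|
    .letIn (.var 2)
      (.mk
        [(.pair (.var 0) .tt,
          .letIn (.pair (.var 1) (.var 2)) (.var 0) (.var 0) <|
          .val (.pair (.var 1) (.succ (.var 2)))),
         (.pair (.var 0) .ff, .val (.pair (.var 0) .zero))])
      (.var 1) <|
    .val (.var 2))]

/-- β-reduction lifts `ω` below the `fix`; closedness makes the lift trivial. -/
theorem iter_step {ω : Iso} (hω : ω.ClosedAt 0) : Iso.Step (.app iter ω) (iterFix ω) := by
  have h := hω.lift
  have hs : Iso.Step (.app iter ω) _ := Iso.Step.beta _ ω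
  simpa [iterFix, Iso.mk, Clauses.ofList, Iso.subst, Clauses.subst, h] using hs

theorem big_iterFix_ff {ω : Iso} (hω : ω.ClosedAt 0) {x y : Val} (hx : x.Closed) (hy : y.Closed)
    (h : Big ω x (.pair y .ff)) : Big (iterFix ω) x (.pair y .zero) :=
  .fix_clause [x, .pair y .ff, .pair y .zero] (by simp [hx, hy]) (.head _)
    (by simp [wellScoped_iff]) rfl rfl
    ⟨h.subst_closed hω _ _,
      .clause [y] (by simp [hy]) (.tail _ _ (.head _)) (by simp [wellScoped_iff]) rfl rfl trivial,
      trivial⟩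

theorem big_iterFix_tt {ω : Iso} (hω : ω.ClosedAt 0) {x y z n : Val} (hx : x.Closed)
    (hy : y.Closed) (hz : z.Closed) (hn : n.Closed)
    (h : Big ω x (.pair y .tt)) (h' : Big (iterFix ω) y (.pair z n)) :
    Big (iterFix ω) x (.pair z n.succ) :=
  .fix_clause [x, .pair y .tt, .pair z n.succ] (by simp [hx, hy, hz, hn]) (.head _)
    (by simp [wellScoped_iff]) rfl rfl
    ⟨h.subst_closed hω _ _,
      .clause [y, z, n] (by simp [hy, hz, hn]) (.head _) (by simp [wellScoped_iff]) rfl rfl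
        ⟨h', trivial⟩,
      trivial⟩

/-- The two garbage values are consumed by `h.inv` and `h'.inv`, and the two copies of `a` by the
inverse duplication, so nothing but `b` is left. -/
theorem big_garRem {A B : Ty} {ω ω' : Iso} {a b g g' : Val} (ha : a.Closed) (hb : b.Closed)
    (hg : g.Closed) (hg' : g'.Closed) (hA : Big (dup A) a (.pair a a))
    (hB : Big (dup B) b (.pair b b)) (h : Big ω a (.pair b g)) (h' : Big ω' b (.pair a g')) :
    Big (garRem A B ω ω') a b :=
  .clause [a, b, g, b, b, a, a, g', a, b] (by simp [ha, hb, hg, hg']) (.head _)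
    (by simp [wellScoped_iff]) rfl rfl ⟨h, hB, h.inv, h', hA.inv, h'.inv, trivial⟩

end RevLang

/-! ### Simulation of reversible Turing machines -/

namespace RTM

open RevLang Turing

-- Half tapes up to outer blanks, and inverse runs.

section Tape

variable {Γ : Type*} [Inhabited Γ]

theorem mk_append_default (l : List Γ) :
    ListBlank.mk (l ++ [default]) = ListBlank.mk l :=
  (Quotient.sound (s := BlankRel.setoid Γ) (Or.inl ⟨1, rfl⟩)).symm

/-- Equal half tapes are extensions of one another by blanks; a blank-free `w` cannot properly
extend `l` by blanks. -/
theorem eq_append_replicate_of_mk_eq {l w : List Γ} (hw : default ∉ w)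
    (h : ListBlank.mk l = ListBlank.mk w) : ∃ k, l = w ++ List.replicate k default := by
  have h : BlankRel l w := Quotient.exact (s := BlankRel.setoid Γ) h
  rcases h with ⟨k, rfl⟩ | h
  · cases k with
    | zero => exact ⟨0, by simp⟩
    | succ k => simp [List.replicate_succ] at hw
  · exact h

theorem Act.Rel.inv {a : Act Γ} {T T' : Tape Γ} (h : a.Rel T T') : a.inv.Rel T' T := by
  cases a with
  | write s s' =>
    obtain ⟨rfl, rfl⟩ := h
    exact ⟨rfl, rfl⟩
  | left => cases h; simp [Act.inv, Act.Rel]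
  | right => cases h; simp [Act.inv, Act.Rel]
  | stay => cases h; rfl

theorem Machine.Steps.inv {Q : Type*} {M : Machine Q Γ} {C C' : Conf Q Γ} (h : M.Steps C C') :
    M.inv.Steps C' C := by
  induction h with
  | refl => exact .refl
  | tail _ h ih =>
    obtain ⟨a, hm, ha⟩ := h
    exact .head ⟨a.inv, Finset.mem_map.2 ⟨_, hm, rfl⟩, ha.inv⟩ ih

end Tape

theorem Machine.inv_no_rule_from_qf {Q Γ : Type*} {M : Machine Q Γ} (hM : M.IsReversible) :
    ∀ a q', (M.inv.qf, a, q') ∉ M.inv.δ := by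
  intro a q' h
  obtain ⟨⟨q, b, q''⟩, hm, he⟩ := Finset.mem_map.1 h
  obtain rfl : q'' = M.qs := congrArg Prod.fst he
  exact hM.no_rule_into_qs _ _ hm

-- Encoded configurations and their duplication and padding.

section Simulation

variable {Q Γ : Type*} {n m : ℕ} (eQ : Q ≃ Fin n) (eΓ : Γ ≃ Fin m)

@[simp] theorem closed_enc {X : Type*} {n : ℕ} (e : X ≃ Fin n) (x : X) : (enc e x).Closed :=
  Val.closed_finInj _ _

@[simp] theorem vars_enc {X : Type*} {n : ℕ} (e : X ≃ Fin n) (x : X) : (enc e x).vars = [] :=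
  closed_enc e x

theorem big_dup_enc {X : Type*} {n : ℕ} (e : X ≃ Fin n) (x : X) :
    Big (dup (.finSum n)) (enc e x) (.pair (enc e x) (enc e x)) :=
  big_dup_finSum (e x).2

/-- The encoding of a string of symbols. -/
def encList (l : List Γ) : Val := .ofList (l.map (enc eΓ))

@[simp] theorem closed_encList (l : List Γ) : (encList eΓ l).Closed := by
  simp [encList]

theorem encList_cons (a : Γ) (l : List Γ) :
    encList eΓ (a :: l) = .cons (enc eΓ a) (encList eΓ l) := rfl

theorem big_dup_encList (l : List Γ) :
    Big (dup (.list (.finSum m))) (encList eΓ l) (.pair (encList eΓ l) (encList eΓ l)) :=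
  big_dup_list (dup_finSum_closedAt m) fun v hv => by
    obtain ⟨a, _, rfl⟩ := List.mem_map.1 hv
    exact ⟨closed_enc _ _, big_dup_enc _ _⟩

/-- The encoding of a configuration whose two half tapes start next to the head. -/
def encConf (q : Q) (l : List Γ) (s : Γ) (r : List Γ) : Val :=
  .pair (enc eQ q) (.pair (encList eΓ l) (.pair (enc eΓ s) (encList eΓ r)))

@[simp] theorem closed_encConf (q : Q) (l : List Γ) (s : Γ) (r : List Γ) :
    (encConf eQ eΓ q l s r).Closed := by
  simp [encConf]

theorem big_dup_encConf (q : Q) (l : List Γ) (s : Γ) (r : List Γ) :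
    Big (dup (confTy n m)) (encConf eQ eΓ q l s r)
      (.pair (encConf eQ eΓ q l s r) (encConf eQ eΓ q l s r)) :=
  big_dup_tensor (by simp) (by simp) (big_dup_enc _ _)
    (big_dup_tensor (by simp) (by simp) (big_dup_encList _ _)
      (big_dup_tensor (by simp) (by simp) (big_dup_enc _ _) (big_dup_encList _ _)))

variable [Inhabited Γ]

theorem big_growthIso (l r : List Γ) :
    Big (growthIso eΓ) (.pair (encList eΓ l) (encList eΓ r))
      (.pair (encList eΓ (l ++ [default])) (encList eΓ (r ++ [default]))) := by
  simp only [encList, List.map_append]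
  exact big_growth (dup_finSum_closedAt m) (by simp) (by simp) (by simp) (big_dup_enc _ _)

theorem growthIso_closedAt : (growthIso eΓ).ClosedAt 0 :=
  growth_closedAt (dup_finSum_closedAt m) _

theorem big_padIso (q : Q) (l : List Γ) (s : Γ) (r : List Γ) :
    Big (padIso eΓ) (encConf eQ eΓ q l s r)
      (encConf eQ eΓ q (l ++ [default]) s (r ++ [default])) :=
  .clause [enc eQ q, encList eΓ l, enc eΓ s, encList eΓ r, encList eΓ (l ++ [default]),
      encList eΓ (r ++ [default])]
    (by simp) (.head _)
    (by simp [wellScoped_iff, InScope, Val.vars, Pat.vars, Expr.letPats, Expr.lets, Expr.result])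
    rfl rfl ⟨big_growthIso eΓ l r, trivial⟩

-- Machine steps, complete runs and the final clean-up.

variable [DecidableEq Q]

theorem rulesIso_closedAt (qf : Q) (δ : List (Q × Act Γ × Q)) :
    (rulesIso eQ eΓ qf δ).ClosedAt 0 := by
  refine Clauses.closedAt_ofList fun c hc => ?_
  obtain ⟨⟨q, a, q'⟩, _, rfl⟩ := List.mem_map.1 hc
  cases a <;> exact ⟨growthIso_closedAt eΓ, trivial⟩

/-- Whether the new state is final, as a boolean of the language. -/
def haltFlag (qf q : Q) : Val := if q = qf then .ff else .tt

@[simp] theorem closed_haltFlag (qf q : Q) : (haltFlag qf q).Closed := by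
  unfold haltFlag; split <;> simp

@[simp] theorem vars_haltFlag (qf q : Q) : (haltFlag qf q).vars = [] := closed_haltFlag qf q

/-- One environment, ordered as the variables of `ruleClause`, serves all four actions; entries
absent from a clause are arbitrary. -/
theorem big_ruleClause {δ : List (Q × Act Γ × Q)} {qf q q' : Q} {a : Act Γ}
    (h : (q, a, q') ∈ δ) {u u' : Val} (z y : Γ) (l r : List Γ)
    (hs : WellScoped (ruleClause eQ eΓ (q, a, q') (haltFlag qf q')).1
      (ruleClause eQ eΓ (q, a, q') (haltFlag qf q')).2)
    (hu : (ruleClause eQ eΓ (q, a, q') (haltFlag qf q')).1.bind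
      (env [encList eΓ l, encList eΓ r, enc eΓ z, enc eΓ y, encList eΓ (l ++ [default]),
        encList eΓ (r ++ [default])]) = u)
    (hu' : (ruleClause eQ eΓ (q, a, q') (haltFlag qf q')).2.result.bind
      (env [encList eΓ l, encList eΓ r, enc eΓ z, enc eΓ y, encList eΓ (l ++ [default]),
        encList eΓ (r ++ [default])]) = u') :
    Big (rulesIso eQ eΓ qf δ) u u' := by
  refine .clause _ (by simp) (Clauses.mem_ofList (List.mem_map.2 ⟨_, h, rfl⟩)) hs hu hu' ?_
  cases a <;> exact ⟨big_growthIso eΓ l r, trivial⟩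

theorem wellScoped_ruleClause (t : Q × Act Γ × Q) (qf : Q) :
    WellScoped (ruleClause eQ eΓ t (haltFlag qf t.2.2)).1
      (ruleClause eQ eΓ t (haltFlag qf t.2.2)).2 := by
  obtain ⟨q, a, q'⟩ := t
  cases a <;>
    simp [ruleClause, wellScoped_iff, InScope, Val.vars, Pat.vars, Expr.letPats, Expr.lets,
      Expr.result]

/-- One step of a machine on a tape whose two halves are given by nonempty strings. -/
theorem exists_big_rulesIso {δ : List (Q × Act Γ × Q)} {qf q q' : Q} {a : Act Γ}
    (h : (q, a, q') ∈ δ) {l r : List Γ} {s : Γ} (hl : l ≠ []) (hr : r ≠ []) {T' : Tape Γ}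
    (ha : a.Rel ⟨s, ListBlank.mk l, ListBlank.mk r⟩ T') :
    ∃ l' s' r', l' ≠ [] ∧ r' ≠ [] ∧ T' = ⟨s', ListBlank.mk l', ListBlank.mk r'⟩ ∧
      Big (rulesIso eQ eΓ qf δ) (encConf eQ eΓ q l s r)
        (.pair (encConf eQ eΓ q' l' s' r') (haltFlag qf q')) := by
  have hs := wellScoped_ruleClause eQ eΓ (q, a, q') qf
  cases a with
  | write s₁ s₂ =>
    obtain ⟨rfl, rfl⟩ := ha
    -- The clause for writing contains neither variable 2 nor variable 3; `s` merely fills both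
    -- entries.
    refine ⟨l ++ [default], s₂, r ++ [default], by simp, by simp, ?_,
      big_ruleClause eQ eΓ h s s l r hs ?_ ?_⟩
    · simp [Tape.write, mk_append_default]
    · simp [ruleClause, Val.bind, (closed_enc _ _).bind, env, encConf]
    · simp [ruleClause, Val.bind, (closed_enc _ _).bind, env, encConf, Expr.result,
        (closed_haltFlag _ _).bind]
  | stay =>
    cases ha
    refine ⟨l ++ [default], s, r ++ [default], by simp, by simp, ?_,
      big_ruleClause eQ eΓ h s s l r hs ?_ ?_⟩
    · simp [mk_append_default]
    · simp [ruleClause, Val.bind, (closed_enc _ _).bind, env, encConf]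
    · simp [ruleClause, Val.bind, (closed_enc _ _).bind, env, encConf, Expr.result,
        (closed_haltFlag _ _).bind]
  | left =>
    cases ha
    -- The nonempty left list supplies the cell to move onto; the appended blank keeps the remainder
    -- nonempty.
    obtain ⟨y, l, rfl⟩ := List.exists_cons_of_ne_nil hl
    refine ⟨l ++ [default], y, s :: (r ++ [default]), by simp, by simp, ?_,
      big_ruleClause eQ eΓ h s y l r hs ?_ ?_⟩
    · simpa [Tape.move, mk_append_default l] using (mk_append_default (s :: r)).symm
    · simp [ruleClause, Val.bind, Val.cons, (closed_enc _ _).bind, env, encConf, encList_cons]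
    · simp [ruleClause, Val.bind, Val.cons, (closed_enc _ _).bind, env, encConf, encList_cons,
        Expr.result, (closed_haltFlag _ _).bind]
  | right =>
    cases ha
    obtain ⟨y, r, rfl⟩ := List.exists_cons_of_ne_nil hr
    refine ⟨s :: (l ++ [default]), y, r ++ [default], by simp, by simp, ?_,
      big_ruleClause eQ eΓ h s y l r hs ?_ ?_⟩
    · simpa [Tape.move, mk_append_default r] using (mk_append_default (s :: l)).symm
    · simp [ruleClause, Val.bind, Val.cons, (closed_enc _ _).bind, env, encConf, encList_cons]
    · simp [ruleClause, Val.bind, Val.cons, (closed_enc _ _).bind, env, encConf, encList_cons,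
        Expr.result, (closed_haltFlag _ _).bind]

/-- Induction on the run from its start. The lists `l` and `r` are tied to `C` only through its
tape, since the iso accumulates blanks that the strings of `C` need not contain. -/
theorem exists_big_iterFix {M : Machine Q Γ} (hqf : ∀ a q', (M.qf, a, q') ∉ M.δ)
    {C C' : Conf Q Γ} (h : M.Steps C C') (hC : C.state ≠ M.qf) (hC' : C'.state = M.qf)
    {l r : List Γ} {s : Γ} (hl : l ≠ []) (hr : r ≠ [])
    (hT : C.tape = ⟨s, ListBlank.mk l, ListBlank.mk r⟩) :
    ∃ l' s' r' k, C'.tape = ⟨s', ListBlank.mk l', ListBlank.mk r'⟩ ∧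
      Big (iterFix (M.isosB eQ eΓ)) (encConf eQ eΓ C.state l s r)
        (.pair (encConf eQ eΓ M.qf l' s' r') (.ofNat k)) := by
  have hω : (M.isosB eQ eΓ).ClosedAt 0 := rulesIso_closedAt eQ eΓ _ _
  induction h using Relation.ReflTransGen.head_induction_on generalizing l s r with
  | refl => exact absurd hC' hC
  | @head C D hCD hD ih =>
    obtain ⟨a, hm, ha⟩ := hCD
    rw [hT] at ha
    obtain ⟨l₁, s₁, r₁, hl₁, hr₁, hT₁, hb⟩ :=
      exists_big_rulesIso eQ eΓ (qf := M.qf) (Finset.mem_toList.2 hm) hl hr ha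
    by_cases hq : D.state = M.qf
    · have hDC : D = C' := by
        rcases Relation.ReflTransGen.cases_head hD with hD | ⟨E, ⟨b, hb, _⟩, _⟩
        · exact hD
        · rw [hq] at hb
          exact absurd hb (hqf _ _)
      subst hDC
      refine ⟨l₁, s₁, r₁, 0, hT₁, ?_⟩
      rw [haltFlag, if_pos hq, hq] at hb
      exact big_iterFix_ff hω (by simp) (by simp) hb
    · obtain ⟨l', s', r', k, hT', hk⟩ := ih hq hl₁ hr₁ hT₁
      rw [haltFlag, if_neg hq] at hb
      exact ⟨l', s', r', k + 1, hT',
        big_iterFix_tt hω (by simp) (by simp) (by simp) (by simp) hb hk⟩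

theorem enc_mem_nonBlanks {a : Γ} (ha : a ≠ default) : enc eΓ a ∈ nonBlanks eΓ :=
  List.mem_map.2 ⟨eΓ a, by simpa using ha, by simp⟩

/-- Assumes of `M` only what holds for the inverse machine as well, so that it applies to both runs.
-/
theorem exists_big_cleanUpIt {M : Machine Q Γ} (hqf : ∀ a q', (M.qf, a, q') ∉ M.δ)
    (hne : M.qs ≠ M.qf) {w w' : List Γ} (hw' : default ∉ w')
    (h : M.Steps (Conf.standard M.qs w) (Conf.standard M.qf w')) :
    ∃ g : Val, g.Closed ∧ Big (cleanUpIt eΓ (M.isosB eQ eΓ)) (encConf eQ eΓ M.qs [] default w)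
      (.pair (encConf eQ eΓ M.qf [] default w') g) := by
  -- Padding makes both initial lists nonempty without changing the tape.
  obtain ⟨l, s, r, k, hT, hb⟩ := exists_big_iterFix eQ eΓ hqf h hne rfl
    (l := [] ++ [default]) (r := w ++ [default]) (s := default) (by simp) (by simp)
    (by rw [mk_append_default, mk_append_default]; rfl)
  obtain ⟨hs, hl, hr⟩ := Tape.mk.inj hT
  have hs : s = default := hs.symm
  -- The left list represents a blank half tape, hence consists of blanks; the right one is `w'`
  -- followed by blanks.
  obtain ⟨i, rfl⟩ := eq_append_replicate_of_mk_eq (w := []) (by simp) hl.symm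
  obtain ⟨j, rfl⟩ := eq_append_replicate_of_mk_eq hw' hr.symm
  subst hs
  rw [List.nil_append] at hb
  have hc := big_cleanUp (as := nonBlanks eΓ) (w := w'.map (enc eΓ)) (dup_finSum_closedAt m)
    (closed_enc eΓ default) (big_dup_enc _ _) (closed_enc eQ M.qf) (closed_enc eΓ default)
    (Val.closed_ofNat k) (fun v hv => by
      obtain ⟨a, ha, rfl⟩ := List.mem_map.1 hv
      exact ⟨closed_enc _ _, big_dup_enc _ _,
        enc_mem_nonBlanks eΓ fun h => hw' (h ▸ ha)⟩) i j
  have hi : List.replicate i (enc eΓ default) = (List.replicate i default).map (enc eΓ) := by simp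
  have hj : List.replicate j (enc eΓ default) = (List.replicate j default).map (enc eΓ) := by simp
  rw [hi, hj, ← List.map_append] at hc
  have hω : (M.isosB eQ eΓ).ClosedAt 0 := rulesIso_closedAt eQ eΓ _ _
  refine ⟨.pair (.ofNat k) (.pair (.ofNat i) (.pair (.ofNat j)
    (encList eΓ (w' ++ List.replicate j default)))), by simp, ?_⟩
  exact .clause [encConf eQ eΓ M.qs [] default w,
      encConf eQ eΓ M.qs ([] ++ [default]) default (w ++ [default]),
      .pair (encConf eQ eΓ M.qf (List.replicate i default) default
        (w' ++ List.replicate j default)) (.ofNat k),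
      .pair (encConf eQ eΓ M.qf [] default w') (.pair (.ofNat k) (.pair (.ofNat i) (.pair (.ofNat j)
        (encList eΓ (w' ++ List.replicate j default)))))]
    (by simp) (.head _)
    (by simp [wellScoped_iff, InScope, Val.vars, Pat.vars, Expr.letPats, Expr.lets, Expr.result])
    rfl rfl ⟨big_padIso eQ eΓ _ _ _ _, .step (iter_step hω) hb, hc, trivial⟩

end Simulation

end RTM

theorem mainTheorem9 {Q Γ : Type*} [DecidableEq Q] [Inhabited Γ] {n m : ℕ}
    (eQ : Q ≃ Fin n) (eΓ : Γ ≃ Fin m) (M : RTM.Machine Q Γ) (hM : M.IsReversible)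
    (hne : M.qs ≠ M.qf) (w w' : List Γ) (hw : default ∉ w) (hw' : default ∉ w')
    (hrun : M.Steps (RTM.Conf.standard M.qs w) (RTM.Conf.standard M.qf w')) :
    RevLang.Term.Reduces
      (.app
        (RevLang.garRem (RTM.confTy n m) (RTM.confTy n m)
          (RTM.cleanUpIt eΓ (M.isosB eQ eΓ))
          (RTM.cleanUpIt eΓ (M.inv.isosB eQ eΓ)))
        ((RTM.Conf.standard M.qs w).isos eQ eΓ).toTerm)
      ((RTM.Conf.standard M.qf w').isos eQ eΓ).toTerm := by
  obtain ⟨g, hg, h⟩ := RTM.exists_big_cleanUpIt eQ eΓ hM.no_rule_from_qf hne hw' hrun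
  obtain ⟨g', hg', h'⟩ := RTM.exists_big_cleanUpIt eQ eΓ (M := M.inv)
    (RTM.Machine.inv_no_rule_from_qf hM) hne.symm hw hrun.inv
  -- For a standard configuration the left string is empty, so `Conf.isos` and `encConf` agree by
  -- definition.
  exact (RevLang.big_garRem (RTM.closed_encConf eQ eΓ _ _ _ _) (RTM.closed_encConf eQ eΓ _ _ _ _)
    hg hg' (RTM.big_dup_encConf eQ eΓ _ _ _ _) (RTM.big_dup_encConf eQ eΓ _ _ _ _) h h').reduces
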